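/- Let $f:\mathbb R^n\times\mathbb R^m\to\mathbb R$ be three times continuously differentiable, let $f(x,\cdot)$ be $\mu$-strongly concave for every $x\in\mathbb R^n$, with $\mu>0$ independent of $x$, and let the value function $\Phi(x):=\max_{y\in\mathbb R^m}f(x,y)$ be bounded below. For $\beta>0$ put $h_\beta(x,y):=f(x,y)+\frac{\beta}{2}\|\nabla_yf(x,y)\|^2$. All norms are Euclidean. **Algorithm (parameter-free GDA).** Input: $x_0\in\mathbb R^n$, $y_0\in\mathbb R^m$, $\beta_0>0$, $c>0$, $\eta_y^{\max}>\eta_y^{\min}>0$, $\eta_x^{\max}>\eta_x^{\min}>0$, $\alpha\in(0,1)$, $0<\gamma_x<\gamma_y<1$, $\tau\in(0,1]$ and $\{\tau_k\}_k\subseteq[\tau,1]$. Set $F_0=f(x_0,y_0)$, $G_0=\|\nabla_yf(x_0,y_0)\|^2$. For $k=0,1,2,\dots$: 1. While $\langle\nabla_yh_{\beta_k}(x_k,y_k),\nabla_yf(x_k,y_k)\rangle>-c\|\nabla_yf(x_k,y_k)\|^2$, replace $\beta_k$ by $2\beta_k$. Then put $H_k=F_k+\beta_kG_k/2$ and $\Xi_k=\max\{H_k,h_{\beta_k}(x_k,y_k)\}$.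 2. Choose an initial step $\eta_y$: $\eta_y=\eta_y^{\max}$ if $k=0$; if $k\ge1$, with $u=y_k-y_{k-1}$ and $v=\nabla_yf(x_k,y_k)-\nabla_yf(x_{k-1},y_{k-1})$, take either $\eta_y=\min\{\eta_y^{\max},\max\{\|u\|^2/|\langle u,v\rangle|,\eta_y^{\min}\}\}$ or $\eta_y=\min\{\eta_y^{\max},\max\{|\langle u,v\rangle|/\|v\|^2,\eta_y^{\min}\}\}$. Let $\eta_{y,k}$ be the largest element of $\{\eta_y\alpha^l:l=0,1,2,\dots\}$ with $$h_{\beta_k}(x_k,y_k+\eta_{y,k}\nabla_yf(x_k,y_k))\le\Xi_k-\gamma_yc\,\eta_{y,k}\|\nabla_yf(x_k,y_k)\|^2,$$ and put $y_{k+1}=y_k+\eta_{y,k}\nabla_yf(x_k,y_k)$. 3. Choose an initial step $\eta_x$: $\eta_x=\eta_x^{\max}$ if $k=0$; if $k\ge1$, by either of the two formulas of item 2 with $\eta_x^{\min},\eta_x^{\max}$ in place of $\eta_y^{\min},\eta_y^{\max}$, and with $u=x_k-x_{k-1}$ and $v=\nabla_xf(x_k,y_{k+1})-\nabla_xf(x_{k-1},y_k)$.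 Let $\eta_{x,k}$ be the largest element of $\{\eta_x\alpha^l:l=0,1,2,\dots\}$ with $$h_{\beta_k}(x_k-\eta_{x,k}\nabla_xf(x_k,y_{k+1}),y_{k+1})\le\Xi_k-\gamma_x\Big(c\,\eta_{y,k}\|\nabla_yf(x_k,y_k)\|^2+\frac{\eta_{x,k}}2\|\nabla_xf(x_k,y_{k+1})\|^2\Big),$$ and put $x_{k+1}=x_k-\eta_{x,k}\nabla_xf(x_k,y_{k+1})$. 4. Put $F_{k+1}=(1-\tau_k)F_k+\tau_kf(x_{k+1},y_{k+1})$, $G_{k+1}=(1-\tau_k)G_k+\tau_k\|\nabla_yf(x_{k+1},y_{k+1})\|^2$, $\beta_{k+1}=\beta_k$. (In the step-size quotients $a/0=+\infty$ for $a>0$, and if the quotient is $0/0$ then any initial step between the lower and the upper bound may be taken. The algorithm is run without a stopping criterion.) **Theorem.** Let $\{(x_k,y_k)\}_k$ be generated by this algorithm, and suppose that it is bounded. (1) The function $\Phi$ is differentiable, $\nabla f(x_k,y_k)\to0$ and $\nabla\Phi(x_k)\to0$ as $k\to\infty$, and $$\min_{0\le k\le T}\|\nabla f(x_k,y_k)\|=O(T^{-1/2}),\qquad\min_{0\le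 k\le T}\|\nabla\Phi(x_k)\|=O(T^{-1/2}).$$ (2) Say that $\Phi$ has the KL property at $\bar x$ with exponent $\theta\in[\frac12,1)$ if there are $C>0$ and a neighborhood $U$ of $\bar x$ with $\|\nabla\Phi(x)\|\ge C|\Phi(x)-\Phi(\bar x)|^\theta$ for all $x\in U$. If at every $\bar x$ with $\nabla\Phi(\bar x)=0$ the function $\Phi$ has the KL property with some exponent in $[\frac12,1)$ (which may depend on $\bar x$), then $(x_k,y_k)$ converges to a first-order minimax point $(x^*,y^*)$, that is, $\nabla\Phi(x^*)=0$ and $y^*\in\arg\max_yf(x^*,y)$. Moreover, if $\theta$ is a KL exponent of $\Phi$ at $x^*$, then $$\|(x_k,y_k)-(x^*,y^*)\|=\begin{cases}O(q^k)\text{ for some }q\in(0,1),&\text{if }\theta=\frac12,\\ O\big(k^{-\frac{1-\theta}{2\theta-1}}\big),&\text{if }\theta\in(\frac12,1).\end{cases}$$ No relation between the values $\beta_k$ (or their final value) and $\mu^{-1}$ is assumed. -/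

import Mathlib

open Filter Topology Asymptotics

noncomputable section

/-- Euclidean space `ℝᵈ`. -/
abbrev Euc (d : ℕ) : Type := EuclideanSpace ℝ (Fin d)

/-- `ℝⁿ × ℝᵐ` with the Euclidean norm `‖(x, y)‖² = ‖x‖² + ‖y‖²`. -/
abbrev EucProd (n m : ℕ) : Type := WithLp 2 (Euc n × Euc m)

/-- The point `(x, y)` of `ℝⁿ × ℝᵐ`. -/
def pt {n m : ℕ} (x : Euc n) (y : Euc m) : EucProd n m := WithLp.toLp 2 (x, y)

/-- `f` as a function of the joint variable `z = (x, y)`; its `gradient` is `∇f`. -/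
def joint {n m : ℕ} (f : Euc n → Euc m → ℝ) (z : EucProd n m) : ℝ := f z.fst z.snd

/-- The partial gradient `∇ₓ f(x, y)`. -/
def gradX {n m : ℕ} (f : Euc n → Euc m → ℝ) (x : Euc n) (y : Euc m) : Euc n :=
  gradient (fun x' => f x' y) x

/-- The partial gradient `∇_y f(x, y)`. -/
def gradY {n m : ℕ} (f : Euc n → Euc m → ℝ) (x : Euc n) (y : Euc m) : Euc m :=
  gradient (fun y' => f x y') y

/-- The value function `Φ(x) = max_y f(x, y)`. -/
def valueFn {n m : ℕ} (f : Euc n → Euc m → ℝ) (x : Euc n) : ℝ := ⨆ y, f x y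

/-- The regularized objective `h_β(x, y) = f(x, y) + (β / 2) ‖∇_y f(x, y)‖²`. -/
def hReg {n m : ℕ} (f : Euc n → Euc m → ℝ) (β : ℝ) (x : Euc n) (y : Euc m) : ℝ :=
  f x y + β / 2 * ‖gradY f x y‖ ^ 2

/-- Standing assumptions: `f` is `C³`, every `f(x, ·)` is `μ`-strongly concave with one `μ > 0`,
and the value function is bounded below. -/
structure NCSCProblem {n m : ℕ} (f : Euc n → Euc m → ℝ) (μ : ℝ) : Prop where
  contDiff : ContDiff ℝ 3 (joint f)
  mu_pos : 0 < μ
  strongConcave : ∀ x, StrongConcaveOn Set.univ μ (f x)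
  bddBelow : BddBelow (Set.range (valueFn f))

/-- `(x, y)` is a first-order minimax point: `∇Φ(x) = 0` and `y` maximizes `f(x, ·)`. -/
def IsFirstOrderMinimax {n m : ℕ} (f : Euc n → Euc m → ℝ) (x : Euc n) (y : Euc m) : Prop :=
  HasGradientAt (valueFn f) 0 x ∧ ∀ y', f x y' ≤ f x y

/-- `F` satisfies the KL (Łojasiewicz) property at `p` with exponent `θ ∈ [1/2, 1)`. -/
def KLAt {d : ℕ} (F : Euc d → ℝ) (p : Euc d) (θ : ℝ) : Prop :=
  θ ∈ Set.Ico (1 / 2 : ℝ) 1 ∧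
    ∃ C > 0, ∃ U ∈ 𝓝 p, ∀ x ∈ U, C * |F x - F p| ^ θ ≤ ‖gradient F x‖

/-- `η = min {hi, max {a / b, lo}}`, where `a, b ≥ 0`; here `a / 0 = +∞` if `a ≠ 0`, and for the
undefined quotient `0 / 0` any value in `[lo, hi]` is admitted. -/
def IsClippedQuotient (lo hi a b η : ℝ) : Prop :=
  (b ≠ 0 ∧ η = min hi (max (a / b) lo)) ∨
  (b = 0 ∧ a ≠ 0 ∧ η = hi) ∨
  (b = 0 ∧ a = 0 ∧ lo ≤ η ∧ η ≤ hi)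

/-- The Barzilai–Borwein rule: `η` is the clipped BB1 quotient `‖u‖² / |⟨u, v⟩|` or the
clipped BB2 quotient `|⟨u, v⟩| / ‖v‖²`. -/
def IsBBStep {d : ℕ} (lo hi : ℝ) (u v : Euc d) (η : ℝ) : Prop :=
  IsClippedQuotient lo hi (‖u‖ ^ 2) |inner ℝ u v| η ∨
  IsClippedQuotient lo hi |inner ℝ u v| (‖v‖ ^ 2) η

/-- `η` is the largest element of `{η₀ αˡ : l = 0, 1, 2, …}` satisfying `accept`. -/
def IsBacktrack (η₀ α : ℝ) (accept : ℝ → Prop) (η : ℝ) : Prop :=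
  IsGreatest {s | (∃ l : ℕ, s = η₀ * α ^ l) ∧ accept s} η

/-- `b'` is the value with which `while continue b do b ← 2 b` ends when started at `b`. -/
def IsDoublingResult (cont : ℝ → Prop) (b b' : ℝ) : Prop :=
  ∃ l : ℕ, b' = 2 ^ l * b ∧ ¬ cont b' ∧ ∀ j < l, cont (2 ^ j * b)

/-- The input of the parameter-free GDA method. -/
structure GDAInput (n m : ℕ) where
  x₀ : Euc n
  y₀ : Euc m
  β₀ : ℝ
  c : ℝ
  ηyMin : ℝ
  ηyMax : ℝ
  ηxMin : ℝ
  ηxMax : ℝ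
  α : ℝ
  γx : ℝ
  γy : ℝ
  τ : ℝ
  τs : ℕ → ℝ
  β₀_pos : 0 < β₀
  c_pos : 0 < c
  ηyMin_pos : 0 < ηyMin
  ηyMin_lt : ηyMin < ηyMax
  ηxMin_pos : 0 < ηxMin
  ηxMin_lt : ηxMin < ηxMax
  α_mem : α ∈ Set.Ioo (0 : ℝ) 1
  γx_pos : 0 < γx
  γx_lt : γx < γy
  γy_lt : γy < 1
  τ_mem : τ ∈ Set.Ioc (0 : ℝ) 1
  τs_mem : ∀ k, τs k ∈ Set.Icc τ 1

/-- An (infinite) run of the parameter-free GDA method with adaptive step sizes and nonmonotone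
line search on `f`. The fields `βin k` and `β k` are the values of `β_k` before and after the
doubling loop of iteration `k`. -/
structure GDARun {n m : ℕ} (f : Euc n → Euc m → ℝ) (P : GDAInput n m) where
  x : ℕ → Euc n
  y : ℕ → Euc m
  βin : ℕ → ℝ
  β : ℕ → ℝ
  F : ℕ → ℝ
  G : ℕ → ℝ
  H : ℕ → ℝ
  Ξ : ℕ → ℝ
  ηyInit : ℕ → ℝ
  ηy : ℕ → ℝ
  ηxInit : ℕ → ℝ
  ηx : ℕ → ℝ
  x_zero : x 0 = P.x₀
  y_zero : y 0 = P.y₀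
  βin_zero : βin 0 = P.β₀
  F_zero : F 0 = f P.x₀ P.y₀
  G_zero : G 0 = ‖gradY f P.x₀ P.y₀‖ ^ 2
  β_loop : ∀ k, IsDoublingResult
    (fun b => inner ℝ (gradY (hReg f b) (x k) (y k)) (gradY f (x k) (y k))
      > -P.c * ‖gradY f (x k) (y k)‖ ^ 2) (βin k) (β k)
  H_eq : ∀ k, H k = F k + β k * G k / 2
  Ξ_eq : ∀ k, Ξ k = max (H k) (hReg f (β k) (x k) (y k))
  ηyInit_zero : ηyInit 0 = P.ηyMax
  ηyInit_succ : ∀ k, IsBBStep P.ηyMin P.ηyMax (y (k + 1) - y k)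
    (gradY f (x (k + 1)) (y (k + 1)) - gradY f (x k) (y k)) (ηyInit (k + 1))
  ηy_search : ∀ k, IsBacktrack (ηyInit k) P.α
    (fun η => hReg f (β k) (x k) (y k + η • gradY f (x k) (y k))
      ≤ Ξ k - P.γy * P.c * η * ‖gradY f (x k) (y k)‖ ^ 2) (ηy k)
  y_succ : ∀ k, y (k + 1) = y k + ηy k • gradY f (x k) (y k)
  ηxInit_zero : ηxInit 0 = P.ηxMax
  ηxInit_succ : ∀ k, IsBBStep P.ηxMin P.ηxMax (x (k + 1) - x k)
    (gradX f (x (k + 1)) (y (k + 2)) - gradX f (x k) (y (k + 1))) (ηxInit (k + 1))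
  ηx_search : ∀ k, IsBacktrack (ηxInit k) P.α
    (fun η => hReg f (β k) (x k - η • gradX f (x k) (y (k + 1))) (y (k + 1))
      ≤ Ξ k - P.γx * (P.c * ηy k * ‖gradY f (x k) (y k)‖ ^ 2
          + η / 2 * ‖gradX f (x k) (y (k + 1))‖ ^ 2)) (ηx k)
  x_succ : ∀ k, x (k + 1) = x k - ηx k • gradX f (x k) (y (k + 1))
  F_succ : ∀ k, F (k + 1) = (1 - P.τs k) * F k + P.τs k * f (x (k + 1)) (y (k + 1))
  G_succ : ∀ k, G (k + 1)
    = (1 - P.τs k) * G k + P.τs k * ‖gradY f (x (k + 1)) (y (k + 1))‖ ^ 2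
  βin_succ : ∀ k, βin (k + 1) = β k

/-- The iterate `z_k = (x_k, y_k)` of a run. -/
def GDARun.z {n m : ℕ} {f : Euc n → Euc m → ℝ} {P : GDAInput n m} (R : GDARun f P) (k : ℕ) :
    EucProd n m := pt (R.x k) (R.y k)

/-- `min_{k = 0, …, T} a_k`. -/
def runningMin (a : ℕ → ℝ) (T : ℕ) : ℝ :=
  (Finset.range (T + 1)).inf' Finset.nonempty_range_add_one a

end

/-! ### Partial gradients -/

/-! Strong concavity gives ⟨∇_y h_β, ∇_y f⟩ ≤ (1 - βμ)‖∇_y f‖², so β is doubled only finitely often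
and ends at some b, whose relation to 1/μ plays no role (`GDARun.exists_β_eq`). From then on put s_k
= ‖∇ₓf(x_k, y_{k+1})‖ + ‖∇_y f(x_k, y_k)‖. Compactness keeps the step sizes away from 0, so
h_b(z_{k+1}) ≤ Ξ_k - κ s_k², and s_k controls the step length and ∇f at both ends of the step
(`GDARun.exists_decrease`). Since Ξ_{k+1} ≤ (1 - τ)Ξ_k + τ h_b(z_{k+1}), the values Ξ_k decrease to
a limit l and ∑ s_k² < ∞. This gives part (1), because ‖∇Φ(x)‖ is bounded by a multiple of ‖∇f(x,
y)‖ on bounded sets.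

For part (2) no KL inequality for h_b is needed, only an upper bound: f ≤ Φ yields h_b(z) - Φ(p) ≤
Φ(x) - Φ(p) + (b/2)‖∇_y f‖², and the KL property of Φ turns the right side into C‖∇f(z)‖^(1/θ)
(`KLAt.exists_hReg_sub_le`). One side suffices because the gap is measured by δ_k = Ξ_k - l ≥ 0,
with l = Φ(p) at a cluster point. Thus δ_{k+1} ≤ (1 - τ)δ_k + C s_k^(1/θ): either δ drops by a fixed
factor, or δ^θ is at most a multiple of s. Both cases give s ≤ A(δ^(1-θ) - δ'^(1-θ)) and δ' ≤ δ - a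
δ^(2θ) (`exists_step_bounds`). The first bound telescopes to finite length and convergence, the
second gives the rates (`MapClusterPt.tendsto_and_rates`). -/

theorem hasFDerivAt_pt_right {n m : ℕ} (x : Euc n) (y : Euc m) :
    ∃ A : Euc m →L[ℝ] EucProd n m, (∀ v, A v = pt 0 v) ∧ HasFDerivAt (fun y' => pt x y') A y :=
  ⟨_, fun _ => rfl, (WithLp.prodContinuousLinearEquiv 2 ℝ (Euc n) (Euc m)).symm.hasFDerivAt.comp y
    (hasFDerivAt_prodMk_right (𝕜 := ℝ) x y)⟩

theorem hasFDerivAt_pt_left {n m : ℕ} (x : Euc n) (y : Euc m) :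
    ∃ A : Euc n →L[ℝ] EucProd n m, (∀ v, A v = pt v 0) ∧ HasFDerivAt (fun x' => pt x' y) A x :=
  ⟨_, fun _ => rfl, (WithLp.prodContinuousLinearEquiv 2 ℝ (Euc n) (Euc m)).symm.hasFDerivAt.comp x
    (hasFDerivAt_prodMk_left (𝕜 := ℝ) x y)⟩

theorem norm_pt_sq {n m : ℕ} (x : Euc n) (y : Euc m) : ‖pt x y‖ ^ 2 = ‖x‖ ^ 2 + ‖y‖ ^ 2 :=
  WithLp.prod_norm_sq_eq_of_L2 _

theorem norm_euc_fst_le {n m : ℕ} (z : EucProd n m) : ‖z.fst‖ ≤ ‖z‖ := by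
  refine le_of_sq_le_sq ?_ (norm_nonneg _)
  rw [WithLp.prod_norm_sq_eq_of_L2]
  nlinarith [sq_nonneg ‖z.snd‖]

theorem norm_euc_snd_le {n m : ℕ} (z : EucProd n m) : ‖z.snd‖ ≤ ‖z‖ := by
  refine le_of_sq_le_sq ?_ (norm_nonneg _)
  rw [WithLp.prod_norm_sq_eq_of_L2]
  nlinarith [sq_nonneg ‖z.fst‖]

theorem norm_le_fst_add_snd {n m : ℕ} (z : EucProd n m) : ‖z‖ ≤ ‖z.fst‖ + ‖z.snd‖ := by
  refine le_of_sq_le_sq ?_ (by positivity)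
  rw [WithLp.prod_norm_sq_eq_of_L2]
  nlinarith [norm_nonneg z.fst, norm_nonneg z.snd]

theorem norm_pt_zero_left {n m : ℕ} (v : Euc m) : ‖(pt 0 v : EucProd n m)‖ = ‖v‖ := by
  rw [← sq_eq_sq₀ (norm_nonneg _) (norm_nonneg _), norm_pt_sq]; simp

theorem norm_pt_zero_right {n m : ℕ} (v : Euc n) : ‖(pt v 0 : EucProd n m)‖ = ‖v‖ := by
  rw [← sq_eq_sq₀ (norm_nonneg _) (norm_nonneg _), norm_pt_sq]; simp

theorem continuous_pt {n m : ℕ} : Continuous fun p : Euc n × Euc m => pt p.1 p.2 :=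
  (WithLp.prodContinuousLinearEquiv 2 ℝ (Euc n) (Euc m)).symm.continuous

theorem hasFDerivAt_partial_right {n m : ℕ} {φ : Euc n → Euc m → ℝ} {x : Euc n} {y : Euc m}
    (h : DifferentiableAt ℝ (joint φ) (pt x y)) : DifferentiableAt ℝ (φ x) y ∧
      ∀ v, inner ℝ (gradY φ x y) v = fderiv ℝ (joint φ) (pt x y) (pt 0 v) := by
  obtain ⟨A, hA, hd⟩ := hasFDerivAt_pt_right x y
  have h1 : HasFDerivAt (φ x) ((fderiv ℝ (joint φ) (pt x y)).comp A) y :=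
    h.hasFDerivAt.comp y hd
  refine ⟨h1.differentiableAt, fun v => ?_⟩
  rw [gradY, inner_gradient_left, h1.fderiv, ContinuousLinearMap.comp_apply, hA]

theorem hasFDerivAt_partial_left {n m : ℕ} {φ : Euc n → Euc m → ℝ} {x : Euc n} {y : Euc m}
    (h : DifferentiableAt ℝ (joint φ) (pt x y)) : DifferentiableAt ℝ (fun x' => φ x' y) x ∧
      ∀ v, inner ℝ (gradX φ x y) v = fderiv ℝ (joint φ) (pt x y) (pt v 0) := by
  obtain ⟨A, hA, hd⟩ := hasFDerivAt_pt_left x y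
  have h1 : HasFDerivAt (fun x' => φ x' y) ((fderiv ℝ (joint φ) (pt x y)).comp A) x :=
    HasFDerivAt.comp (f := fun x' => pt x' y) x h.hasFDerivAt hd
  refine ⟨h1.differentiableAt, fun v => ?_⟩
  rw [gradX, inner_gradient_left, h1.fderiv, ContinuousLinearMap.comp_apply, hA]

theorem gradY_eq_snd {n m : ℕ} {φ : Euc n → Euc m → ℝ} {x : Euc n} {y : Euc m}
    (h : DifferentiableAt ℝ (joint φ) (pt x y)) :
    gradY φ x y = (gradient (joint φ) (pt x y)).snd := by
  refine ext_inner_right ℝ fun v => ?_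
  rw [(hasFDerivAt_partial_right h).2, ← inner_gradient_left, WithLp.prod_inner_apply]
  simp [pt]

theorem gradX_eq_fst {n m : ℕ} {φ : Euc n → Euc m → ℝ} {x : Euc n} {y : Euc m}
    (h : DifferentiableAt ℝ (joint φ) (pt x y)) :
    gradX φ x y = (gradient (joint φ) (pt x y)).fst := by
  refine ext_inner_right ℝ fun v => ?_
  rw [(hasFDerivAt_partial_left h).2, ← inner_gradient_left, WithLp.prod_inner_apply]
  simp [pt]

theorem ContDiff.gradient_succ {d : ℕ} {E : Type*} [NormedAddCommGroup E] [InnerProductSpace ℝ E]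
    [CompleteSpace E] {φ : E → ℝ} (h : ContDiff ℝ (d + 1) φ) : ContDiff ℝ d (gradient φ) :=
  (InnerProductSpace.toDual ℝ E).symm.toContinuousLinearEquiv.contDiff.comp
    (h.fderiv_right le_rfl)

/-! ### Strong concavity -/

/-- The chord inequality on the segment from y to w is divided by t, and t → 0+ turns the slope into
the gradient term. -/
theorem StrongConcaveOn.le_add_inner_gradient {E : Type*} [NormedAddCommGroup E]
    [InnerProductSpace ℝ E] [CompleteSpace E] {φ : E → ℝ} {μ : ℝ}
    (h : StrongConcaveOn Set.univ μ φ) {y : E} (hd : DifferentiableAt ℝ φ y) (w : E) :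
    φ w ≤ φ y + inner ℝ (gradient φ y) (w - y) - μ / 2 * ‖w - y‖ ^ 2 := by
  have h1 : HasDerivAt (fun t : ℝ => φ (y + t • (w - y))) (inner ℝ (gradient φ y) (w - y)) 0 := by
    have h2 : HasDerivAt (fun t : ℝ => y + t • (w - y)) (w - y) 0 := by
      simpa using ((hasDerivAt_id (0 : ℝ)).smul_const (w - y)).const_add y
    rw [inner_gradient_left]
    refine HasFDerivAt.comp_hasDerivAt (0 : ℝ) (l := φ) ?_ h2
    simpa using hd.hasFDerivAt
  have h3 := h1.tendsto_slope_zero_right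
  have h4 : Tendsto (fun t : ℝ => φ w - φ y + (1 - t) * (μ / 2 * ‖w - y‖ ^ 2)) (𝓝[>] 0)
      (𝓝 (φ w - φ y + (1 - 0) * (μ / 2 * ‖w - y‖ ^ 2))) := by
    apply tendsto_nhdsWithin_of_tendsto_nhds
    apply Continuous.tendsto
    fun_prop
  have h5 := le_of_tendsto_of_tendsto h4 h3 (by
    filter_upwards [Ioo_mem_nhdsGT (zero_lt_one' ℝ)] with t ht
    have h6 := h.2 (Set.mem_univ y) (Set.mem_univ w) (sub_nonneg.2 ht.2.le) ht.1.le (by ring)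
    have h7 : (1 - t) • y + t • w = y + t • (w - y) := by module
    rw [h7, norm_sub_rev] at h6
    simp only [smul_eq_mul, zero_add, zero_smul, add_zero] at h6 ⊢
    rw [le_inv_mul_iff₀ ht.1]
    linarith)
  linarith

section NCSC

variable {n m : ℕ} {f : Euc n → Euc m → ℝ} {μ : ℝ}

theorem NCSCProblem.differentiable (hf : NCSCProblem f μ) : Differentiable ℝ (joint f) :=
  hf.contDiff.differentiable (by norm_num)

theorem NCSCProblem.contDiff_gradient (hf : NCSCProblem f μ) :
    ContDiff ℝ 2 (gradient (joint f)) :=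
  ContDiff.gradient_succ (d := 2) hf.contDiff

theorem NCSCProblem.gradY_eq (hf : NCSCProblem f μ) (x : Euc n) (y : Euc m) :
    gradY f x y = (gradient (joint f) (pt x y)).snd := gradY_eq_snd (hf.differentiable _)

theorem NCSCProblem.gradX_eq (hf : NCSCProblem f μ) (x : Euc n) (y : Euc m) :
    gradX f x y = (gradient (joint f) (pt x y)).fst := gradX_eq_fst (hf.differentiable _)

theorem NCSCProblem.le_add_inner (hf : NCSCProblem f μ) (x : Euc n) (y w : Euc m) :
    f x w ≤ f x y + inner ℝ (gradY f x y) (w - y) - μ / 2 * ‖w - y‖ ^ 2 :=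
  (hf.strongConcave x).le_add_inner_gradient (hasFDerivAt_partial_right (hf.differentiable _)).1 w

theorem NCSCProblem.inner_gradY_sub_le (hf : NCSCProblem f μ) (x : Euc n) (y w : Euc m) :
    inner ℝ (gradY f x w - gradY f x y) (w - y) ≤ -μ * ‖w - y‖ ^ 2 := by
  have h1 := hf.le_add_inner x y w
  have h2 := hf.le_add_inner x w y
  rw [norm_sub_rev, ← neg_sub w y, inner_neg_right] at h2
  rw [inner_sub_left]
  linarith

theorem NCSCProblem.exists_isMax (hf : NCSCProblem f μ) (x : Euc n) :
    ∃ y, ∀ w, f x w ≤ f x y := by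
  have hc : Continuous (f x) := by
    have : Continuous fun y => joint f (pt x y) :=
      hf.contDiff.continuous.comp (continuous_pt.comp (by fun_prop : Continuous fun y : Euc m => (x, y)))
    exact this
  refine hc.exists_forall_ge' 0 ?_
  -- Beyond the radius 2‖∇_y f(x, 0)‖/μ the quadratic term beats the linear one, so f(x, y) ≤ f(x,
  -- 0).
  filter_upwards [(tendsto_norm_cocompact_atTop (E := Euc m)).eventually_ge_atTop
    (2 * ‖gradY f x 0‖ / μ)] with y hy
  have h1 := hf.le_add_inner x 0 y
  have h2 := real_inner_le_norm (gradY f x 0) (y - 0)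
  rw [div_le_iff₀ hf.mu_pos] at hy
  simp only [sub_zero] at h1 h2
  nlinarith [norm_nonneg y]

/-- A maximizer of `f x`. -/
noncomputable def NCSCProblem.argmax (hf : NCSCProblem f μ) (x : Euc n) : Euc m :=
  (hf.exists_isMax x).choose

theorem NCSCProblem.le_argmax (hf : NCSCProblem f μ) (x : Euc n) (w : Euc m) :
    f x w ≤ f x (hf.argmax x) := (hf.exists_isMax x).choose_spec w

theorem NCSCProblem.valueFn_eq (hf : NCSCProblem f μ) (x : Euc n) :
    valueFn f x = f x (hf.argmax x) :=
  le_antisymm (ciSup_le (hf.le_argmax x))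
    (le_ciSup (f := f x) ⟨f x (hf.argmax x), by rintro _ ⟨w, rfl⟩; exact hf.le_argmax x w⟩ _)

theorem NCSCProblem.gradY_argmax (hf : NCSCProblem f μ) (x : Euc n) :
    gradY f x (hf.argmax x) = 0 := by
  have h : IsLocalMax (f x) (hf.argmax x) := Eventually.of_forall (hf.le_argmax x)
  refine ext_inner_right ℝ fun v => ?_
  rw [gradY, inner_gradient_left, h.fderiv_eq_zero]
  simp

/-- Strong monotonicity between y and the maximizer, where the gradient vanishes, followed by
Cauchy–Schwarz. Uniqueness and continuity of the maximizer and the comparison of ∇Φ with ∇f all rest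
on this error bound. -/
theorem NCSCProblem.norm_sub_argmax_le (hf : NCSCProblem f μ) (x : Euc n) (y : Euc m) :
    ‖hf.argmax x - y‖ ≤ ‖gradY f x y‖ / μ := by
  have h1 := hf.inner_gradY_sub_le x y (hf.argmax x)
  rw [hf.gradY_argmax, zero_sub, inner_neg_left] at h1
  have h2 := real_inner_le_norm (gradY f x y) (hf.argmax x - y)
  rw [le_div_iff₀ hf.mu_pos]
  rcases (norm_nonneg (hf.argmax x - y)).eq_or_lt with h | h
  · rw [← h, zero_mul]; exact norm_nonneg _
  · refine le_of_mul_le_mul_right ?_ h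
    nlinarith

theorem NCSCProblem.argmax_eq (hf : NCSCProblem f μ) {x : Euc n} {y : Euc m}
    (h : gradY f x y = 0) : hf.argmax x = y := by
  have := hf.norm_sub_argmax_le x y
  rw [h, norm_zero, zero_div] at this
  exact sub_eq_zero.1 (norm_le_zero_iff.1 this)

theorem NCSCProblem.continuous_gradY_left (hf : NCSCProblem f μ) (y : Euc m) :
    Continuous fun x => gradY f x y := by
  simp_rw [hf.gradY_eq]
  exact (WithLp.sndL 2 ℝ (Euc n) (Euc m)).continuous.comp (hf.contDiff_gradient.continuous.comp
    (continuous_pt.comp (by fun_prop : Continuous fun x : Euc n => (x, y))))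

/-- The error bound is applied at x' to the frozen point y = `hf.argmax x`, whose partial gradient
tends to 0 as x' → x. -/
theorem NCSCProblem.continuous_argmax (hf : NCSCProblem f μ) : Continuous hf.argmax := by
  refine continuous_iff_continuousAt.2 fun x => tendsto_iff_norm_sub_tendsto_zero.2 ?_
  have h : Tendsto (fun x' => ‖gradY f x' (hf.argmax x)‖ / μ) (𝓝 x) (𝓝 0) := by
    have := (((hf.continuous_gradY_left (hf.argmax x)).norm).div_const μ).tendsto x
    simpa [hf.gradY_argmax] using this
  exact squeeze_zero (fun _ => norm_nonneg _) (fun x' => hf.norm_sub_argmax_le x' _) h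

/-- Danskin's theorem. -/
theorem NCSCProblem.hasGradientAt_valueFn (hf : NCSCProblem f μ) (x : Euc n) :
    HasGradientAt (valueFn f) (gradX f x (hf.argmax x)) x := by
  -- Strictness is needed because one of the two difference quotients below has the moving base
  -- point (x, `hf.argmax x'`).
  have hs : HasStrictFDerivAt (joint f) (fderiv ℝ (joint f) (pt x (hf.argmax x)))
      (pt x (hf.argmax x)) := hf.contDiff.contDiffAt.hasStrictFDerivAt (by norm_num)
  have h0 : Tendsto (fun x' => pt x' (hf.argmax x')) (𝓝 x) (𝓝 (pt x (hf.argmax x))) :=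
    (continuous_pt.comp (continuous_id.prodMk hf.continuous_argmax)).tendsto x
  have h1 : Tendsto (fun x' => pt x (hf.argmax x')) (𝓝 x) (𝓝 (pt x (hf.argmax x))) :=
    (continuous_pt.comp (continuous_const.prodMk hf.continuous_argmax)).tendsto x
  have h2 : Tendsto (fun x' => pt x' (hf.argmax x)) (𝓝 x) (𝓝 (pt x (hf.argmax x))) :=
    (continuous_pt.comp (continuous_id.prodMk continuous_const)).tendsto x
  have k1 := hs.isLittleO.comp_tendsto (h0.prodMk_nhds h1)
  have k2 := hs.isLittleO.comp_tendsto (h2.prodMk_nhds (tendsto_const_nhds (x := pt x (hf.argmax x))))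
  have e : ∀ (x' : Euc n) (y : Euc m), pt x' y - pt x y = pt (x' - x) 0 := fun x' y => by
    simp [pt, ← WithLp.toLp_sub]
  simp only [Function.comp_def, e, ← (hasFDerivAt_partial_left (hf.differentiable _)).2] at k1 k2
  rw [hasGradientAt_iff_isLittleO, isLittleO_iff]
  rw [isLittleO_iff] at k1 k2
  intro c hc
  filter_upwards [k1 hc, k2 hc] with x' e1 e2
  rw [norm_pt_zero_right, Real.norm_eq_abs, abs_le] at e1 e2
  rw [Real.norm_eq_abs, abs_le, hf.valueFn_eq, hf.valueFn_eq]
  -- By maximality, Φ(x') - Φ(x) lies between the increments of f in x at y = `hf.argmax x` and at y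
  -- = `hf.argmax x'`; both have the same linear part up to o(‖x' - x‖).
  have a1 := hf.le_argmax x' (hf.argmax x)
  have a2 := hf.le_argmax x (hf.argmax x')
  change _ ≤ f x' (hf.argmax x') - f x (hf.argmax x') - _ ∧
    f x' (hf.argmax x') - f x (hf.argmax x') - _ ≤ _ at e1
  change _ ≤ f x' (hf.argmax x) - f x (hf.argmax x) - _ ∧
    f x' (hf.argmax x) - f x (hf.argmax x) - _ ≤ _ at e2
  constructor <;> linarith [e1.1, e1.2, e2.1, e2.2]

theorem NCSCProblem.gradient_valueFn (hf : NCSCProblem f μ) (x : Euc n) :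
    gradient (valueFn f) x = gradX f x (hf.argmax x) := (hf.hasGradientAt_valueFn x).gradient

/-! ### The regularized objective -/

theorem NCSCProblem.joint_hReg (hf : NCSCProblem f μ) (b : ℝ) : joint (hReg f b) =
    fun z => joint f z + b / 2 * ‖WithLp.sndL 2 ℝ (Euc n) (Euc m) (gradient (joint f) z)‖ ^ 2 := by
  funext z
  simp only [joint, hReg, hf.gradY_eq]
  rfl

theorem NCSCProblem.contDiff_hReg (hf : NCSCProblem f μ) (b : ℝ) :
    ContDiff ℝ 2 (joint (hReg f b)) := by
  rw [hf.joint_hReg]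
  exact (hf.contDiff.of_le (by norm_num)).add (contDiff_const.mul
    (((WithLp.sndL 2 ℝ (Euc n) (Euc m)).contDiff.comp hf.contDiff_gradient).norm_sq ℝ))

theorem fderiv_add_half_mul_norm_sq {E F : Type*} [NormedAddCommGroup E] [NormedSpace ℝ E]
    [NormedAddCommGroup F] [InnerProductSpace ℝ F] {φ : E → ℝ} {g : E → E} (S : E →L[ℝ] F)
    {z : E} (hφ : DifferentiableAt ℝ φ z) (hg : DifferentiableAt ℝ g z) (b : ℝ) (w : E) :
    fderiv ℝ (fun z => φ z + b / 2 * ‖S (g z)‖ ^ 2) z w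
      = fderiv ℝ φ z w + b * inner ℝ (S (g z)) (S (fderiv ℝ g z w)) := by
  have h : HasFDerivAt (fun z => φ z + b / 2 * ‖S (g z)‖ ^ 2) _ z :=
    hφ.hasFDerivAt.add ((S.hasFDerivAt.comp z hg.hasFDerivAt).norm_sq.const_mul (b / 2))
  rw [h.fderiv]
  simp
  ring

theorem NCSCProblem.fderiv_hReg (hf : NCSCProblem f μ) (b : ℝ) (z w : EucProd n m) :
    fderiv ℝ (joint (hReg f b)) z w = inner ℝ (gradient (joint f) z) w
      + b * inner ℝ (gradient (joint f) z).snd (fderiv ℝ (gradient (joint f)) z w).snd := by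
  rw [hf.joint_hReg, inner_gradient_left]
  exact fderiv_add_half_mul_norm_sq _ (hf.differentiable z)
    (hf.contDiff_gradient.differentiable (by norm_num) z) b w

/-- Infinitesimal form of the strong monotonicity of ∇_y f: the difference quotient along y + tv,
with t → 0+. -/
theorem NCSCProblem.inner_fderiv_gradient_le (hf : NCSCProblem f μ) (x : Euc n) (y v : Euc m) :
    inner ℝ (fderiv ℝ (gradient (joint f)) (pt x y) (pt 0 v)).snd v ≤ -μ * ‖v‖ ^ 2 := by
  obtain ⟨A, hA, hd⟩ := hasFDerivAt_pt_right x y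
  have hg : HasFDerivAt (gradient (joint f)) (fderiv ℝ (gradient (joint f)) (pt x y)) (pt x y) :=
    (hf.contDiff_gradient.differentiable (by norm_num) _).hasFDerivAt
  have h1 := (WithLp.sndL 2 ℝ (Euc n) (Euc m)).hasFDerivAt.comp y (hg.comp y hd)
  have h2 : HasDerivAt (fun t : ℝ => y + t • v) v 0 := by
    simpa using ((hasDerivAt_id (0 : ℝ)).smul_const v).const_add y
  have h3 := HasFDerivAt.comp_hasDerivAt_of_eq (0 : ℝ) h1 h2 (by simp)
  have h4 := h3.tendsto_slope_zero_right.inner (𝕜 := ℝ) (tendsto_const_nhds (x := v))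
  simp only [Function.comp_def, ContinuousLinearMap.comp_apply, hA, WithLp.sndL_apply,
    ← hf.gradY_eq] at h4
  refine le_of_tendsto h4 ?_
  filter_upwards [self_mem_nhdsWithin] with t ht
  have ht : 0 < t := ht
  have h5 := hf.inner_gradY_sub_le x y (y + t • v)
  simp only [add_sub_cancel_left, norm_smul, inner_smul_right, Real.norm_eq_abs, mul_pow,
    sq_abs] at h5
  simp only [zero_add, zero_smul, add_zero, real_inner_smul_left]
  rw [inv_mul_le_iff₀ ht]
  refine le_of_mul_le_mul_left ?_ ht
  linarith

theorem NCSCProblem.inner_gradY_hReg (hf : NCSCProblem f μ) (b : ℝ) (x : Euc n) (y v : Euc m) :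
    inner ℝ (gradY (hReg f b) x y) v = fderiv ℝ (joint (hReg f b)) (pt x y) (pt 0 v) :=
  (hasFDerivAt_partial_right ((hf.contDiff_hReg b).differentiable (by norm_num) _)).2 v

/-- The reason the doubling loop ends: its test fails as soon as bμ ≥ 1 + c. -/
theorem NCSCProblem.inner_gradY_hReg_le (hf : NCSCProblem f μ) {b : ℝ} (hb : 0 ≤ b) (x : Euc n)
    (y : Euc m) : inner ℝ (gradY (hReg f b) x y) (gradY f x y)
      ≤ (1 - b * μ) * ‖gradY f x y‖ ^ 2 := by
  rw [hf.inner_gradY_hReg, hf.fderiv_hReg, ← hf.gradY_eq, real_inner_comm _ (gradY f x y)]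
  have h1 := mul_le_mul_of_nonneg_left (hf.inner_fderiv_gradient_le x y (gradY f x y)) hb
  have h2 : inner ℝ (gradient (joint f) (pt x y)) (pt 0 (gradY f x y)) = ‖gradY f x y‖ ^ 2 := by
    rw [inner_gradient_left, ← (hasFDerivAt_partial_right (hf.differentiable _)).2,
      real_inner_self_eq_norm_sq]
  rw [h2]
  linarith

end NCSC

/-! ### Sequences of finite length -/

/-- Trapping argument: started near p with small V, the telescoped length keeps the sequence in the
ball, so the local estimate keeps applying. That estimate is conditioned on the new point `z (k +
1)`, where the KL inequality will be used; this is why vanishing step lengths are assumed. -/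
theorem MapClusterPt.tendsto_of_dist_le_sub {E : Type*} [PseudoMetricSpace E] {z : ℕ → E}
    {V : ℕ → ℝ} {p : E} {r : ℝ} (hz : MapClusterPt p atTop z) (hV : Tendsto V atTop (𝓝 0))
    (hV0 : ∀ᶠ k in atTop, 0 ≤ V k) (hd : Tendsto (fun k => dist (z k) (z (k + 1))) atTop (𝓝 0))
    (hr : 0 < r)
    (h : ∀ᶠ k in atTop, z (k + 1) ∈ Metric.ball p r → dist (z k) (z (k + 1)) ≤ V k - V (k + 1)) :
    Tendsto z atTop (𝓝 p) ∧ ∀ᶠ k in atTop, dist (z k) p ≤ V k := by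
  -- One third each for the last step, the travelled length from `z k₀`, and the distance from `z
  -- k₀` to p.
  have hr3 : 0 < r / 3 := by positivity
  obtain ⟨K, hK⟩ := eventually_atTop.1 (hV0.and ((hV.eventually_lt_const hr3).and
    ((hd.eventually_lt_const hr3).and h)))
  have hfreq : ∀ ε > 0, ∀ K, ∃ k ≥ K, dist (z k) p < ε := fun ε hε K =>
    frequently_atTop.1 (hz.frequently (Metric.ball_mem_nhds p hε)) K
  obtain ⟨k₀, hk₀, hp⟩ := hfreq _ hr3 K
  have key : ∀ j, dist (z k₀) (z (k₀ + j)) ≤ V k₀ - V (k₀ + j) ∧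
      dist (z (k₀ + j)) (z (k₀ + j + 1)) ≤ V (k₀ + j) - V (k₀ + j + 1) := by
    intro j
    have aux : ∀ j, dist (z k₀) (z (k₀ + j)) ≤ V k₀ - V (k₀ + j) →
        dist (z (k₀ + j)) (z (k₀ + j + 1)) ≤ V (k₀ + j) - V (k₀ + j + 1) := by
      intro j hj
      obtain ⟨a1, a2, a3, a4⟩ := hK (k₀ + j) (by omega)
      refine a4 (Metric.mem_ball.2 ?_)
      have b1 := dist_triangle4 (z (k₀ + j + 1)) (z (k₀ + j)) (z k₀) p
      have b2 := (hK k₀ hk₀).2.1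
      linarith [dist_comm (z (k₀ + j)) (z k₀), dist_comm (z (k₀ + j)) (z (k₀ + j + 1))]
    have first : ∀ j, dist (z k₀) (z (k₀ + j)) ≤ V k₀ - V (k₀ + j) := by
      intro j
      induction j with
      | zero => simp
      | succ j ih =>
        have := dist_triangle (z k₀) (z (k₀ + j)) (z (k₀ + j + 1))
        have := aux j ih
        rw [← add_assoc]
        linarith
    exact ⟨first j, aux j (first j)⟩
  have tail : ∀ k ≥ k₀, ∀ j, dist (z k) (z (k + j)) ≤ V k - V (k + j) := by
    intro k hk j
    induction j with
    | zero => simp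
    | succ j ih =>
      obtain ⟨i, hi⟩ := Nat.exists_eq_add_of_le (show k₀ ≤ k + j by omega)
      have h1 := (key i).2
      rw [← hi] at h1
      have := dist_triangle (z k) (z (k + j)) (z (k + j + 1))
      rw [← add_assoc]
      linarith
  have bound : ∀ k ≥ k₀, dist (z k) p ≤ V k := by
    intro k hk
    refine le_of_forall_pos_le_add fun ε hε => ?_
    obtain ⟨k', hk', hε'⟩ := hfreq ε hε k
    obtain ⟨i, rfl⟩ := Nat.exists_eq_add_of_le hk'
    have h1 := tail k hk i
    have h2 := (hK (k + i) (by omega)).1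
    have h3 := dist_triangle (z k) (z (k + i)) p
    linarith
  have bound' : ∀ᶠ k in atTop, dist (z k) p ≤ V k := eventually_atTop.2 ⟨k₀, bound⟩
  exact ⟨tendsto_iff_dist_tendsto_zero.2
    (squeeze_zero' (Eventually.of_forall fun _ => dist_nonneg) bound' hV), bound'⟩

/-! ### Sufficient decrease and the Łojasiewicz exponent -/

/-- Tangent-line bound for the concave function t ↦ t^p at δ, from Bernoulli's inequality at δ'/δ -
1. -/
theorem sub_mul_le_rpow_sub_rpow {δ δ' p : ℝ} (hδ : 0 < δ) (hδ' : 0 ≤ δ') (hp : 0 ≤ p)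
    (hp1 : p ≤ 1) : p * (δ - δ') ≤ δ ^ (1 - p) * (δ ^ p - δ' ^ p) := by
  have h1 := rpow_one_add_le_one_add_mul_self (s := δ' / δ - 1)
    (by linarith [div_nonneg hδ' hδ.le]) hp hp1
  rw [add_sub_cancel, Real.div_rpow hδ' hδ.le, div_le_iff₀ (Real.rpow_pos_of_pos hδ p)] at h1
  have h2 : δ ^ (1 - p) * δ ^ p = δ := by
    rw [← Real.rpow_add hδ]; simp
  have h3 := mul_le_mul_of_nonneg_left h1 (Real.rpow_nonneg hδ.le (1 - p))
  have h4 : δ ^ (1 - p) * ((1 + p * (δ' / δ - 1)) * δ ^ p) = δ + p * (δ' - δ) := by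
    calc _ = (1 + p * (δ' / δ - 1)) * (δ ^ (1 - p) * δ ^ p) := by ring
      _ = _ := by rw [h2]; field_simp
  rw [h4] at h3
  rw [mul_sub (δ ^ (1 - p)), h2]
  linarith

theorem exists_step_bounds {θ τ κ C : ℝ} (hθ : θ ∈ Set.Ico (1 / 2 : ℝ) 1) (hτ : 0 < τ)
    (hκ : 0 < κ) (hC : 0 < C) : ∃ A > 0, ∃ a > 0, ∀ δ δ' s : ℝ, 0 ≤ δ' → 0 ≤ s → δ ≤ 1 →
      δ' ≤ δ - κ * s ^ 2 → δ' ≤ (1 - τ) * δ + C * s ^ (1 / θ) →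
      s ≤ A * δ ^ (1 - θ) - A * δ' ^ (1 - θ) ∧ δ' ≤ δ - a * δ ^ (2 * θ) := by
  obtain ⟨hθ1, hθ2⟩ := hθ
  have hθ0 : 0 < θ := by linarith
  -- Chosen so that δ ≤ (2C/τ) s^(1/θ) becomes δ^θ ≤ D s. The two summands of `A'` and the two
  -- entries of `a` serve the two cases below.
  set D : ℝ := (2 * C / τ) ^ θ with hD
  have hD0 : 0 < D := by positivity
  set A' : ℝ := √(2 / (τ * κ)) + D / κ with hA'
  have hA'0 : 0 < A' := by positivity
  set a : ℝ := min (τ / 2) (κ / D ^ 2) with ha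
  have h1θ : 0 < 1 - θ := by linarith
  refine ⟨A' / (1 - θ), by positivity, a, by positivity, fun δ δ' s hδ' hs hδ1 h1 h2 => ?_⟩
  have hks : 0 ≤ κ * s ^ 2 := by positivity
  rcases (show 0 ≤ δ by linarith).eq_or_lt with rfl | hδ
  · have e : δ' = 0 := by linarith
    have es : s = 0 := by
      have : κ * s ^ 2 = 0 := by linarith
      simpa [hκ.ne'] using this
    rw [e, es, Real.zero_rpow h1θ.ne', Real.zero_rpow (by linarith)]
    simp
  -- Concavity of t^(1-θ) converts δ^θ s ≤ A'(δ - δ') into the telescoping bound.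
  suffices h : δ ^ θ * s ≤ A' * (δ - δ') ∧ a * δ ^ (2 * θ) ≤ δ - δ' by
    refine ⟨?_, by linarith [h.2]⟩
    have h3 := sub_mul_le_rpow_sub_rpow hδ hδ' h1θ.le (by linarith)
    rw [sub_sub_cancel] at h3
    rw [← mul_sub, div_mul_eq_mul_div, le_div_iff₀ h1θ]
    have h4 : 0 < δ ^ θ := Real.rpow_pos_of_pos hδ θ
    refine le_of_mul_le_mul_left ?_ h4
    calc δ ^ θ * (s * (1 - θ)) = (1 - θ) * (δ ^ θ * s) := by ring
      _ ≤ (1 - θ) * (A' * (δ - δ')) := mul_le_mul_of_nonneg_left h.1 h1θ.le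
      _ = A' * ((1 - θ) * (δ - δ')) := by ring
      _ ≤ A' * (δ ^ θ * (δ ^ (1 - θ) - δ' ^ (1 - θ))) := by gcongr
      _ = _ := by ring
  have hsd : s ^ 2 ≤ (δ - δ') / κ := by rw [le_div_iff₀ hκ]; linarith
  have hdd : 0 ≤ δ - δ' := by linarith
  -- Either the gap shrinks by a fixed factor, so δ itself is at most (2/τ)(δ - δ'), or the KL term
  -- dominates and δ^θ ≤ D s. The first case uses δ ≤ 1 and θ ≥ 1/2.
  by_cases hc : δ' ≤ (1 - τ / 2) * δ
  · constructor
    · have h3 : δ ^ θ ≤ √δ := by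
        rw [Real.sqrt_eq_rpow]; exact Real.rpow_le_rpow_of_exponent_ge hδ hδ1 hθ1
      calc δ ^ θ * s ≤ √δ * s := by gcongr
        _ = √(δ * s ^ 2) := by rw [Real.sqrt_mul hδ.le, Real.sqrt_sq hs]
        _ ≤ √(2 / (τ * κ) * (δ - δ') ^ 2) := by
            apply Real.sqrt_le_sqrt
            have h4 : δ ≤ 2 / τ * (δ - δ') := by
              rw [div_mul_eq_mul_div, le_div_iff₀ hτ]; linarith
            calc δ * s ^ 2 ≤ (2 / τ * (δ - δ')) * ((δ - δ') / κ) := by gcongr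
              _ = _ := by field_simp
        _ = √(2 / (τ * κ)) * (δ - δ') := by
            rw [Real.sqrt_mul (by positivity), Real.sqrt_sq hdd]
        _ ≤ A' * (δ - δ') := by gcongr; rw [hA']; linarith [div_pos hD0 hκ]
    · have h3 : δ ^ (2 * θ) ≤ δ := by
        simpa using Real.rpow_le_rpow_of_exponent_ge hδ hδ1 (show 1 ≤ 2 * θ by linarith)
      calc a * δ ^ (2 * θ) ≤ τ / 2 * δ := by gcongr; exact min_le_left _ _
        _ ≤ _ := by linarith
  · have h3 : δ ≤ 2 * C / τ * s ^ (1 / θ) := by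
      rw [div_mul_eq_mul_div, le_div_iff₀ hτ]; linarith
    have h4 : δ ^ θ ≤ D * s := by
      have := Real.rpow_le_rpow hδ.le h3 hθ0.le
      rwa [Real.mul_rpow (by positivity) (by positivity), ← Real.rpow_mul hs,
        one_div_mul_cancel hθ0.ne', Real.rpow_one] at this
    constructor
    · calc δ ^ θ * s ≤ D * s * s := by gcongr
        _ = D * s ^ 2 := by ring
        _ ≤ D * ((δ - δ') / κ) := by gcongr
        _ = D / κ * (δ - δ') := by ring
        _ ≤ A' * (δ - δ') := by
          gcongr; rw [hA']; linarith [Real.sqrt_nonneg (2 / (τ * κ))]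
    · have e : δ ^ (2 * θ) = (δ ^ θ) ^ 2 := by
        rw [mul_comm, Real.rpow_mul hδ.le, Real.rpow_two]
      calc a * δ ^ (2 * θ) = a * (δ ^ θ) ^ 2 := by rw [e]
        _ ≤ κ / D ^ 2 * (D * s) ^ 2 := by gcongr; exact min_le_right _ _
        _ = κ * s ^ 2 := by field_simp
        _ ≤ _ := by linarith

/-- The quantity δ^(-(p-1)) grows by at least b = a(p - 1) per step, since 1 - x ≤ exp(-x). The
estimates avoid inverses so that δ may vanish. -/
theorem rpow_le_div_of_le_sub_mul_rpow {δ : ℕ → ℝ} {a p : ℝ} (ha : 0 < a) (hp : 1 < p)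
    (h0 : ∀ᶠ k in atTop, 0 ≤ δ k) (h : ∀ᶠ k in atTop, δ (k + 1) ≤ δ k - a * δ k ^ p) :
    ∃ B > 0, ∀ᶠ k : ℕ in atTop, δ k ^ (p - 1) ≤ B / k := by
  obtain ⟨K, hK⟩ := eventually_atTop.1 (h0.and h)
  have hp1 : 0 < p - 1 := by linarith
  set b : ℝ := a * (p - 1) with hb
  have hb0 : 0 < b := by positivity
  have step : ∀ k ≥ K, δ (k + 1) ^ (p - 1) * (1 + b * δ k ^ (p - 1)) ≤ δ k ^ (p - 1) := by
    intro k hk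
    have d0 := (hK k hk).1
    have d1 := (hK (k + 1) (by omega)).1
    set v := δ k ^ (p - 1) with hv
    have hv0 : 0 ≤ v := Real.rpow_nonneg d0 _
    have h1 : δ k ^ p = δ k * v := by
      rw [hv, ← Real.rpow_one_add' d0 (by linarith)]; congr 1; ring
    have h2 : δ (k + 1) ≤ δ k * Real.exp (-(a * v)) := by
      have := mul_le_mul_of_nonneg_left (Real.add_one_le_exp (-(a * v))) d0
      have := (hK k hk).2
      rw [h1] at this
      linarith
    have h3 := Real.rpow_le_rpow d1 h2 hp1.le
    rw [Real.mul_rpow d0 (Real.exp_pos _).le, ← Real.exp_mul] at h3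
    have h4 : 1 + b * v ≤ Real.exp (b * v) := by linarith [Real.add_one_le_exp (b * v)]
    calc _ ≤ v * Real.exp (-(a * v) * (p - 1)) * Real.exp (b * v) := by gcongr
      _ = v := by 
        rw [mul_assoc, ← Real.exp_add, hb, show -(a * v) * (p - 1) + a * (p - 1) * v = 0 by ring]
        simp
  have key : ∀ j : ℕ, b * j * δ (K + j) ^ (p - 1) ≤ 1 := by
    intro j
    induction j with
    | zero => simp
    | succ j ih =>
      have h1 := step (K + j) (by omega)
      have hv : 0 ≤ δ (K + j) ^ (p - 1) := Real.rpow_nonneg (hK (K + j) (by omega)).1 _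
      set v := δ (K + j) ^ (p - 1)
      rw [← add_assoc]
      have h2 : 0 < 1 + b * v := by positivity
      have h3 : δ (K + j + 1) ^ (p - 1) ≤ v / (1 + b * v) := by rwa [le_div_iff₀ h2]
      calc _ ≤ b * ((j + 1 : ℕ) : ℝ) * (v / (1 + b * v)) := by gcongr
        _ ≤ 1 := by
          rw [← mul_div_assoc, div_le_one h2]; push_cast; linarith
  -- The factor 2 absorbs the shift by K: for k = K + j with j > K one has k ≤ 2j.
  refine ⟨2 / b, by positivity, ?_⟩
  filter_upwards [eventually_ge_atTop (2 * K + 1)] with k hk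
  obtain ⟨j, rfl⟩ := Nat.exists_eq_add_of_le (show K ≤ k by omega)
  have hj : K + 1 ≤ j := by omega
  have hj' : (K : ℝ) + 1 ≤ j := by exact_mod_cast hj
  have hj0 : (0 : ℝ) < j := by linarith [Nat.cast_nonneg (α := ℝ) K]
  have hv := key j
  push_cast
  rw [div_div, le_div_iff₀ (by positivity)]
  have hv0 : 0 ≤ δ (K + j) ^ (p - 1) := Real.rpow_nonneg (hK (K + j) (by omega)).1 _
  have := mul_nonneg hb0.le hv0
  nlinarith

theorem isBigO_pow_of_le_sub_mul {δ : ℕ → ℝ} {a : ℝ} (ha : 0 < a)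
    (h0 : ∀ᶠ k in atTop, 0 ≤ δ k) (h : ∀ᶠ k in atTop, δ (k + 1) ≤ δ k - a * δ k) :
    ∃ q ∈ Set.Ioo (0 : ℝ) 1, ∃ B > 0, ∀ᶠ k : ℕ in atTop, δ k ≤ B * q ^ k := by
  obtain ⟨K, hK⟩ := eventually_atTop.1 (h0.and h)
  -- The maximum with 1/2 keeps q positive when a ≥ 1.
  set q : ℝ := max (1 - a) (1 / 2) with hq
  have hq0 : 0 < q := lt_max_of_lt_right (by norm_num)
  refine ⟨q, ⟨hq0, max_lt (by linarith) (by norm_num)⟩, (δ K + 1) / q ^ K,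
    div_pos (by linarith [(hK K le_rfl).1]) (by positivity), ?_⟩
  refine eventually_atTop.2 ⟨K, fun k hk => ?_⟩
  obtain ⟨j, rfl⟩ := Nat.exists_eq_add_of_le hk
  rw [pow_add, div_mul_eq_mul_div, mul_comm (q ^ K), ← mul_assoc,
    mul_div_assoc, div_self (by positivity), mul_one]
  clear hk
  induction j with
  | zero => simp
  | succ j ih =>
    obtain ⟨h1, h2⟩ := hK (K + j) (by omega)
    calc δ (K + (j + 1)) ≤ (1 - a) * δ (K + j) := by rw [← add_assoc]; linarith
      _ ≤ q * δ (K + j) := by gcongr; exact le_max_left _ _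
      _ ≤ q * ((δ K + 1) * q ^ j) := by gcongr
      _ = _ := by ring

theorem MapClusterPt.tendsto_and_rates {E : Type*} [PseudoMetricSpace E] {z : ℕ → E}
    {δ s : ℕ → ℝ} {p : E} {r θ τ κ C C' : ℝ} (hz : MapClusterPt p atTop z)
    (hθ : θ ∈ Set.Ico (1 / 2 : ℝ) 1) (hτ : 0 < τ) (hκ : 0 < κ) (hC : 0 < C) (hC' : 0 < C')
    (hr : 0 < r) (hδ : Tendsto δ atTop (𝓝 0)) (hδ0 : ∀ᶠ k in atTop, 0 ≤ δ k)
    (hs0 : ∀ k, 0 ≤ s k) (hs : Tendsto s atTop (𝓝 0))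
    (hd : ∀ᶠ k in atTop, dist (z k) (z (k + 1)) ≤ C' * s k)
    (hdec : ∀ᶠ k in atTop, δ (k + 1) ≤ δ k - κ * s k ^ 2)
    (hKL : ∀ᶠ k in atTop, z (k + 1) ∈ Metric.ball p r →
      δ (k + 1) ≤ (1 - τ) * δ k + C * s k ^ (1 / θ)) :
    Tendsto z atTop (𝓝 p) ∧
    (θ = 1 / 2 → ∃ q ∈ Set.Ioo (0 : ℝ) 1,
      (fun k => dist (z k) p) =O[atTop] (fun k : ℕ => q ^ k)) ∧
    (1 / 2 < θ → (fun k => dist (z k) p)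
      =O[atTop] (fun k : ℕ => (k : ℝ) ^ (-((1 - θ) / (2 * θ - 1))))) := by
  obtain ⟨A, hA, a, ha, hstep⟩ := exists_step_bounds hθ hτ hκ hC
  have h1θ : 0 < 1 - θ := by linarith [hθ.2]
  have hδ0' : ∀ᶠ k in atTop, 0 ≤ δ (k + 1) := (tendsto_add_atTop_nat 1).eventually hδ0
  have hV : Tendsto (fun k => C' * (A * δ k ^ (1 - θ))) atTop (𝓝 0) := by
    have := ((hδ.rpow_const (Or.inr h1θ.le) (p := 1 - θ)).const_mul A).const_mul C'
    simpa [Real.zero_rpow h1θ.ne'] using this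
  have hd0 : Tendsto (fun k => dist (z k) (z (k + 1))) atTop (𝓝 0) :=
    squeeze_zero' (Eventually.of_forall fun _ => dist_nonneg) hd (by simpa using hs.const_mul C')
  -- The potential C'A δ^(1-θ) also bounds the distance to the limit, so the rates reduce to rates
  -- for δ.
  obtain ⟨hlim, hdist⟩ := hz.tendsto_of_dist_le_sub hV
    (by filter_upwards [hδ0] with k hk; positivity) hd0 hr (by
      filter_upwards [hd, hdec, hKL, hδ0', hδ.eventually_le_const zero_lt_one]
        with k k1 k2 k3 k4 k5 hk
      have := (hstep _ _ _ k4 (hs0 k) k5 k2 (k3 hk)).1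
      calc _ ≤ C' * s k := k1
        _ ≤ C' * (A * δ k ^ (1 - θ) - A * δ (k + 1) ^ (1 - θ)) := by gcongr
        _ = _ := by ring)
  have hball : ∀ᶠ k in atTop, z (k + 1) ∈ Metric.ball p r :=
    (tendsto_add_atTop_nat 1).eventually (hlim.eventually (Metric.ball_mem_nhds p hr))
  have hdec2 : ∀ᶠ k in atTop, δ (k + 1) ≤ δ k - a * δ k ^ (2 * θ) := by
    filter_upwards [hdec, hKL, hδ0', hδ.eventually_le_const zero_lt_one, hball]
      with k k2 k3 k4 k5 hk
    exact (hstep _ _ _ k4 (hs0 k) k5 k2 (k3 hk)).2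
  refine ⟨hlim, fun h => ?_, fun h => ?_⟩
  · subst h
    obtain ⟨q, hq, B, hB, hqB⟩ := isBigO_pow_of_le_sub_mul ha hδ0 (by
      filter_upwards [hdec2] with k hk; simpa using hk)
    refine ⟨√q, ⟨Real.sqrt_pos.2 hq.1, by rw [Real.sqrt_lt' one_pos]; simpa using hq.2⟩,
      IsBigO.of_bound (C' * (A * √B)) ?_⟩
    filter_upwards [hqB, hdist, hδ0] with k k1 k2 k3
    have e : δ k ^ (1 - 1 / 2 : ℝ) = √(δ k) := by rw [Real.sqrt_eq_rpow]; norm_num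
    rw [e] at k2
    have e2 : √(B * q ^ k) = √B * √q ^ k := by
      rw [Real.sqrt_mul hB.le]; congr 1
      rw [Real.sqrt_eq_iff_mul_self_eq (pow_nonneg hq.1.le k) (by positivity), ← mul_pow,
        Real.mul_self_sqrt hq.1.le]
    rw [Real.norm_of_nonneg dist_nonneg, Real.norm_of_nonneg (by positivity)]
    calc _ ≤ C' * (A * √(δ k)) := k2
      _ ≤ C' * (A * √(B * q ^ k)) := by gcongr
      _ = _ := by rw [e2]; ring
  · obtain ⟨B, hB, hqB⟩ := rpow_le_div_of_le_sub_mul_rpow ha (by linarith) hδ0 hdec2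
    have h2 : 0 < 2 * θ - 1 := by linarith
    set ρ := (1 - θ) / (2 * θ - 1) with hρ
    have hρ0 : 0 < ρ := by positivity
    refine IsBigO.of_bound (C' * (A * B ^ ρ)) ?_
    filter_upwards [hqB, hdist, hδ0] with k k1 k2 k3
    have e : δ k ^ (1 - θ) = (δ k ^ (2 * θ - 1)) ^ ρ := by
      rw [← Real.rpow_mul k3, hρ, mul_div_cancel₀ _ h2.ne']
    rw [e] at k2
    rw [Real.norm_of_nonneg dist_nonneg, Real.norm_of_nonneg (by positivity)]
    calc _ ≤ _ := k2
      _ ≤ C' * (A * (B / k) ^ ρ) := by gcongr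
      _ = _ := by rw [Real.div_rpow hB.le (by positivity), Real.rpow_neg (by positivity)]; ring

/-! ### Nonmonotone averages and running minima -/

/-- T + 1 copies of the squared minimum are bounded by the sum of the series. -/
theorem runningMin_isBigO {a : ℕ → ℝ} (h0 : ∀ k, 0 ≤ a k) (h : Summable fun k => a k ^ 2) :
    (fun T : ℕ => runningMin a T) =O[atTop] (fun T : ℕ => (T : ℝ) ^ (-(1 / 2) : ℝ)) := by
  refine IsBigO.of_bound (√(∑' k, a k ^ 2)) ?_
  filter_upwards [eventually_gt_atTop 0] with T hT
  have hT' : (0 : ℝ) < T := by exact_mod_cast hT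
  have hm : ∀ k ∈ Finset.range (T + 1), runningMin a T ≤ a k := fun k hk =>
    Finset.inf'_le _ hk
  have hm0 : 0 ≤ runningMin a T := Finset.le_inf' _ _ fun k _ => h0 k
  have h1 : (T + 1 : ℝ) * runningMin a T ^ 2 ≤ ∑' k, a k ^ 2 := by
    calc _ = ∑ k ∈ Finset.range (T + 1), runningMin a T ^ 2 := by simp
      _ ≤ ∑ k ∈ Finset.range (T + 1), a k ^ 2 :=
        Finset.sum_le_sum fun k hk => pow_le_pow_left₀ hm0 (hm k hk) 2
      _ ≤ _ := h.sum_le_tsum _ fun k _ => sq_nonneg _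
  rw [Real.norm_of_nonneg hm0, Real.norm_of_nonneg (by positivity), Real.rpow_neg hT'.le,
    ← Real.sqrt_eq_rpow, ← div_eq_mul_inv, ← Real.sqrt_div' _ hT'.le]
  refine Real.le_sqrt_of_sq_le ?_
  rw [le_div_iff₀ hT']
  nlinarith [sq_nonneg (runningMin a T)]

/-- Inserting `h2` into `h1` makes Ξ decrease by τκs². Then h is squeezed: (Ξ_{k+1} - (1 - τ)Ξ_k)/τ
≤ h_{k+1} ≤ Ξ_k. -/
theorem exists_tendsto_of_nonmonotone_decrease {Ξ h s : ℕ → ℝ} {τ κ B : ℝ} {K : ℕ}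
    (hτ : 0 < τ) (hκ : 0 < κ) (hB : ∀ k, B ≤ Ξ k)
    (h1 : ∀ k ≥ K, Ξ (k + 1) ≤ (1 - τ) * Ξ k + τ * h (k + 1))
    (h2 : ∀ k ≥ K, h (k + 1) ≤ Ξ k - κ * s k ^ 2) :
    ∃ l, Tendsto Ξ atTop (𝓝 l) ∧ Tendsto h atTop (𝓝 l) ∧ (∀ k ≥ K, l ≤ Ξ k) ∧
      (∀ k ≥ K, Ξ (k + 1) ≤ Ξ k - τ * κ * s k ^ 2) ∧ Summable fun k => s k ^ 2 := by
  have dec : ∀ k ≥ K, Ξ (k + 1) ≤ Ξ k - τ * κ * s k ^ 2 := fun k hk => by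
    have := mul_le_mul_of_nonneg_left (h2 k hk) hτ.le
    linarith [h1 k hk]
  have anti : Antitone fun j => Ξ (j + K) := antitone_nat_of_succ_le fun j => by
    have := dec (j + K) (by omega)
    rw [add_right_comm]
    linarith [mul_nonneg (mul_pos hτ hκ).le (sq_nonneg (s (j + K)))]
  have hbdd : BddBelow (Set.range fun j => Ξ (j + K)) := ⟨B, by rintro _ ⟨j, rfl⟩; exact hB _⟩
  have lim := tendsto_atTop_ciInf anti hbdd
  set l := ⨅ j, Ξ (j + K)
  have hΞ : Tendsto Ξ atTop (𝓝 l) := (tendsto_add_atTop_iff_nat K).1 lim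
  have hΞ1 : Tendsto (fun k => Ξ (k + 1)) atTop (𝓝 l) := (tendsto_add_atTop_iff_nat 1).2 hΞ
  refine ⟨l, hΞ, ?_, fun k hk => ?_, dec, ?_⟩
  · refine (tendsto_add_atTop_iff_nat 1).1 ?_
    have low : Tendsto (fun k => (Ξ (k + 1) - (1 - τ) * Ξ k) / τ) atTop (𝓝 l) := by
      have := (hΞ1.sub (hΞ.const_mul (1 - τ))).div_const τ
      convert this using 2
      field_simp; ring
    refine tendsto_of_tendsto_of_tendsto_of_le_of_le' low hΞ ?_ ?_
    · filter_upwards [eventually_ge_atTop K] with k hk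
      rw [div_le_iff₀ hτ]
      linarith [h1 k hk]
    · filter_upwards [eventually_ge_atTop K] with k hk
      linarith [h2 k hk, mul_nonneg hκ.le (sq_nonneg (s k))]
  · obtain ⟨j, rfl⟩ := Nat.exists_eq_add_of_le' hk
    exact ciInf_le hbdd j
  · rw [← summable_nat_add_iff K]
    refine summable_of_sum_range_le (c := (Ξ K - B) / (τ * κ)) (fun _ => sq_nonneg _) fun N => ?_
    rw [le_div_iff₀ (by positivity)]
    have : ∀ N, (∑ i ∈ Finset.range N, s (i + K) ^ 2) * (τ * κ) ≤ Ξ K - Ξ (N + K) := by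
      intro N
      induction N with
      | zero => simp
      | succ N ih =>
        rw [Finset.sum_range_succ, add_mul]
        have := dec (N + K) (by omega)
        rw [add_right_comm]
        linarith
    linarith [this N, hB (N + K)]

/-! ### Local bounds for smooth functions -/

theorem Continuous.exists_norm_le_closedBall {E F : Type*} [NormedAddCommGroup E] [ProperSpace E]
    [NormedAddCommGroup F] {g : E → F} (hg : Continuous g) (ρ : ℝ) :
    ∃ L > 0, ∀ z ∈ Metric.closedBall (0 : E) ρ, ‖g z‖ ≤ L := by
  obtain ⟨L, hL⟩ := (isCompact_closedBall (0 : E) ρ).exists_bound_of_continuousOn hg.continuousOn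
  exact ⟨max L 1, by positivity, fun z hz => (hL z hz).trans (le_max_left _ _)⟩

theorem ContDiff.exists_lipschitz_closedBall {E F : Type*} [NormedAddCommGroup E]
    [NormedSpace ℝ E] [ProperSpace E] [NormedAddCommGroup F] [NormedSpace ℝ F] {g : E → F}
    (hg : ContDiff ℝ 1 g) (ρ : ℝ) :
    ∃ L > 0, (∀ z ∈ Metric.closedBall (0 : E) ρ, ‖fderiv ℝ g z‖ ≤ L) ∧
      ∀ z ∈ Metric.closedBall (0 : E) ρ, ∀ w ∈ Metric.closedBall (0 : E) ρ,
        ‖g w - g z‖ ≤ L * ‖w - z‖ := by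
  obtain ⟨L, hL0, hL⟩ := (hg.continuous_fderiv one_ne_zero).exists_norm_le_closedBall ρ
  exact ⟨L, hL0, hL, fun z hz w hw => (convex_closedBall (0 : E) ρ).norm_image_sub_le_of_norm_fderiv_le
    (fun u _ => hg.differentiable one_ne_zero u) hL hz hw⟩

/-- The mean value inequality on the segment gives L instead of the sharp L/2; the step thresholds
below are computed with this L. -/
theorem ContDiff.exists_le_add_fderiv_closedBall {E : Type*} [NormedAddCommGroup E]
    [NormedSpace ℝ E] [ProperSpace E] {φ : E → ℝ} (hφ : ContDiff ℝ 2 φ) (ρ : ℝ) :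
    ∃ L > 0, ∀ z ∈ Metric.closedBall (0 : E) ρ, ∀ w ∈ Metric.closedBall (0 : E) ρ,
      φ w ≤ φ z + fderiv ℝ φ z (w - z) + L * ‖w - z‖ ^ 2 := by
  obtain ⟨L, hL0, -, hL⟩ :=
    (hφ.fderiv_right (m := 1) (by norm_num)).exists_lipschitz_closedBall ρ
  refine ⟨L, hL0, fun z hz w hw => ?_⟩
  have h1 := (convex_segment z w).norm_image_sub_le_of_norm_fderiv_le' (𝕜 := ℝ) (f := φ)
    (φ := fderiv ℝ φ z) (C := L * ‖w - z‖)
    (fun u _ => hφ.differentiable (by norm_num) u) (fun u hu => by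
      refine (hL z hz u ((convex_closedBall (0 : E) ρ).segment_subset hz hw hu)).trans ?_
      gcongr
      rw [segment_eq_image'] at hu
      obtain ⟨t, ht, rfl⟩ := hu
      rw [add_sub_cancel_left, norm_smul, Real.norm_of_nonneg ht.1]
      exact mul_le_of_le_one_left (norm_nonneg _) ht.2)
    (left_mem_segment ℝ z w) (right_mem_segment ℝ z w)
  rw [Real.norm_eq_abs] at h1
  nlinarith [le_of_abs_le h1]

/-! ### Step sizes -/

theorem IsClippedQuotient.mem_Icc {lo hi a b η : ℝ} (h : IsClippedQuotient lo hi a b η)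
    (hlt : lo ≤ hi) : η ∈ Set.Icc lo hi := by
  rcases h with ⟨-, rfl⟩ | ⟨-, -, rfl⟩ | ⟨-, -, h⟩
  · exact ⟨le_min hlt (le_max_right _ _), min_le_left _ _⟩
  · exact ⟨hlt, le_rfl⟩
  · exact h

theorem IsBBStep.mem_Icc {d : ℕ} {lo hi η : ℝ} {u v : Euc d} (h : IsBBStep lo hi u v η)
    (hlt : lo ≤ hi) : η ∈ Set.Icc lo hi :=
  h.elim (fun h => h.mem_Icc hlt) (fun h => h.mem_Icc hlt)

/-- If any trial was rejected, the last rejected one was η/α, which therefore exceeds t. Acceptance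
is required only for s ≤ hi, so that trial points stay in a fixed ball. -/
theorem IsBacktrack.bounds {η₀ α η lo hi t : ℝ} {acc : ℝ → Prop} (h : IsBacktrack η₀ α acc η)
    (hlo : 0 < lo) (hη₀ : η₀ ∈ Set.Icc lo hi) (hα : α ∈ Set.Ioo (0 : ℝ) 1)
    (ht : ∀ s, 0 < s → s ≤ hi → s ≤ t → acc s) :
    0 < η ∧ η ≤ hi ∧ acc η ∧ min lo (α * t) ≤ η := by
  obtain ⟨⟨⟨l, rfl⟩, hacc⟩, hub⟩ := h
  have h0 : 0 < η₀ := hlo.trans_le hη₀.1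
  have hle : ∀ j, η₀ * α ^ j ≤ hi := fun j =>
    (mul_le_of_le_one_right h0.le (pow_le_one₀ hα.1.le hα.2.le)).trans hη₀.2
  have hpos : ∀ j, 0 < η₀ * α ^ j := fun j => mul_pos h0 (pow_pos hα.1 j)
  refine ⟨hpos l, hle l, hacc, ?_⟩
  cases l with
  | zero => simpa using Or.inl hη₀.1
  | succ j =>
    refine min_le_of_right_le ?_
    have e : η₀ * α ^ (j + 1) = α * (η₀ * α ^ j) := by ring
    rw [e]
    refine mul_le_mul_of_nonneg_left (le_of_not_ge fun hs => ?_) hα.1.le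
    have := hub ⟨⟨j, rfl⟩, ht _ (hpos j) (hle j) hs⟩
    rw [e] at this
    nlinarith [hpos j, hα.2]

theorem Monotone.eventually_const_of_nat {N : ℕ → ℕ} (hN : Monotone N)
    (hb : BddAbove (Set.range N)) : ∃ K, ∀ k ≥ K, N k = N K := by
  have h := tendsto_atTop_ciSup hN hb
  rw [nhds_discrete, tendsto_pure, eventually_atTop] at h
  obtain ⟨K, hK⟩ := h
  exact ⟨K, fun k hk => (hK k hk).trans (hK K le_rfl).symm⟩

/-! ### Sufficient decrease along a run -/

section Run

variable {n m : ℕ} {f : Euc n → Euc m → ℝ} {μ : ℝ} {P : GDAInput n m}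

theorem GDARun.β_pos (R : GDARun f P) (k : ℕ) : 0 < R.βin k ∧ 0 < R.β k := by
  have h : ∀ k, 0 < R.βin k → 0 < R.β k := fun k hk => by
    obtain ⟨l, hl, -⟩ := R.β_loop k
    rw [hl]; positivity
  induction k with
  | zero => exact ⟨R.βin_zero ▸ P.β₀_pos, h 0 (R.βin_zero ▸ P.β₀_pos)⟩
  | succ k ih =>
    have := R.βin_succ k ▸ ih.2
    exact ⟨this, h _ this⟩

theorem GDARun.exists_β_eq (hf : NCSCProblem f μ) (R : GDARun f P) :
    ∃ b > 0, ∃ K, ∀ k ≥ K, R.β k = b := by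
  have hdouble : ∀ k, ∃ l : ℕ, R.β k = 2 ^ l * R.βin k ∧
      (l ≠ 0 → R.β k ≤ 2 * ((1 + P.c) / μ)) := by
    intro k
    obtain ⟨l, hl, -, hj⟩ := R.β_loop k
    refine ⟨l, hl, fun h0 => ?_⟩
    obtain ⟨j, rfl⟩ := Nat.exists_eq_succ_of_ne_zero h0
    have h1 := hj j (Nat.lt_succ_self j)
    have hpos : 0 ≤ 2 ^ j * R.βin k := by have := (R.β_pos k).1; positivity
    have h2 := hf.inner_gradY_hReg_le hpos (R.x k) (R.y k)
    -- The value before the last doubling still satisfied the loop condition, hence is at most (1 +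
    -- c)/μ.
    rw [hl, pow_succ', mul_assoc]
    refine mul_le_mul_of_nonneg_left (le_of_not_gt fun h3 => ?_) zero_le_two
    rw [div_lt_iff₀ hf.mu_pos] at h3
    have := mul_nonneg (show 0 ≤ 2 ^ j * R.βin k * μ - (1 + P.c) by linarith)
      (sq_nonneg ‖gradY f (R.x k) (R.y k)‖)
    linarith
  choose l hl hbound using hdouble
  have hβN : ∀ k, R.β k = 2 ^ (∑ i ∈ Finset.range (k + 1), l i) * P.β₀ := by
    intro k
    induction k with
    | zero => simp [hl, R.βin_zero]
    | succ k ih => rw [Finset.sum_range_succ, hl, R.βin_succ, ih, pow_add]; ring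
  have hβle : ∀ k, R.β k ≤ max P.β₀ (2 * ((1 + P.c) / μ)) := by
    intro k
    by_cases h0 : l k = 0
    · induction k with
      | zero => rw [hl, h0, R.βin_zero]; simp
      | succ k ih =>
        rw [hl, h0, R.βin_succ, pow_zero, one_mul]
        by_cases h1 : l k = 0
        · exact ih h1
        · exact (hbound k h1).trans (le_max_right _ _)
    · exact (hbound k h0).trans (le_max_right _ _)
  have hmono : Monotone fun k => ∑ i ∈ Finset.range (k + 1), l i :=
    monotone_nat_of_le_succ fun k => by rw [Finset.sum_range_succ _ (k + 1)]; omega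
  obtain ⟨K, hK⟩ := hmono.eventually_const_of_nat (by
    obtain ⟨B, hB⟩ := exists_nat_ge (max P.β₀ (2 * ((1 + P.c) / μ)) / P.β₀)
    refine ⟨B, ?_⟩
    rintro _ ⟨k, rfl⟩
    have h1 := hβle k
    rw [hβN, ← le_div_iff₀ P.β₀_pos] at h1
    have h2 : 2 ^ (∑ i ∈ Finset.range (k + 1), l i) ≤ B := by exact_mod_cast h1.trans hB
    exact (Nat.lt_two_pow_self.trans_le h2).le)
  refine ⟨R.β K, (R.β_pos K).2, K, fun k hk => ?_⟩
  rw [hβN, hβN]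
  simp only [hK k hk]

theorem GDARun.ηyInit_mem (R : GDARun f P) (k : ℕ) :
    R.ηyInit k ∈ Set.Icc P.ηyMin P.ηyMax := by
  cases k with
  | zero => rw [R.ηyInit_zero]; exact ⟨P.ηyMin_lt.le, le_rfl⟩
  | succ k => exact (R.ηyInit_succ k).mem_Icc P.ηyMin_lt.le

theorem GDARun.ηxInit_mem (R : GDARun f P) (k : ℕ) :
    R.ηxInit k ∈ Set.Icc P.ηxMin P.ηxMax := by
  cases k with
  | zero => rw [R.ηxInit_zero]; exact ⟨P.ηxMin_lt.le, le_rfl⟩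
  | succ k => exact (R.ηxInit_succ k).mem_Icc P.ηxMin_lt.le

/-- Sufficient decrease of the regularized objective along the ascent step in `y`. -/
theorem hReg_ascent_step_le (hf : NCSCProblem f μ) {b c γ L ρ η Ξ : ℝ} {x : Euc n} {y : Euc m}
    (hL : 0 < L) (hdesc : ∀ z ∈ Metric.closedBall (0 : EucProd n m) ρ,
      ∀ w ∈ Metric.closedBall (0 : EucProd n m) ρ, joint (hReg f b) w ≤ joint (hReg f b) z
        + fderiv ℝ (joint (hReg f b)) z (w - z) + L * ‖w - z‖ ^ 2)
    (hexit : inner ℝ (gradY (hReg f b) x y) (gradY f x y) ≤ -c * ‖gradY f x y‖ ^ 2)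
    (hΞ : hReg f b x y ≤ Ξ) (hη : 0 ≤ η) (hη' : η ≤ (1 - γ) * c / L)
    (hz : pt x y ∈ Metric.closedBall 0 ρ)
    (hw : pt x (y + η • gradY f x y) ∈ Metric.closedBall 0 ρ) :
    hReg f b x (y + η • gradY f x y) ≤ Ξ - γ * c * η * ‖gradY f x y‖ ^ 2 := by
  have h1 := hdesc _ hz _ hw
  have e : pt x (y + η • gradY f x y) - pt x y = η • pt 0 (gradY f x y) := by
    simp [pt, ← WithLp.toLp_sub, ← WithLp.toLp_smul]
  rw [e, map_smul, smul_eq_mul, ← hf.inner_gradY_hReg, norm_smul, norm_pt_zero_left,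
    Real.norm_of_nonneg hη] at h1
  change hReg f b x (y + η • gradY f x y) ≤ hReg f b x y + _ + _ at h1
  -- The threshold makes the second-order term Lη²‖∇_y f‖² at most the spared fraction (1 - γ)cη‖∇_y
  -- f‖².
  rw [le_div_iff₀ hL] at hη'
  have h2 := mul_le_mul_of_nonneg_left hexit hη
  have h3 := mul_nonneg (mul_nonneg hη (sub_nonneg.2 hη')) (sq_nonneg ‖gradY f x y‖)
  nlinarith

/-- Sufficient decrease of the regularized objective along the descent step in `x`. -/
theorem hReg_descent_step_le (hf : NCSCProblem f μ) {b γ L L' ρ η Ξ D ν v : ℝ} {x : Euc n}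
    {y : Euc m} (hb : 0 < b) (hL : 0 < L)
    (hdesc : ∀ z ∈ Metric.closedBall (0 : EucProd n m) ρ,
      ∀ w ∈ Metric.closedBall (0 : EucProd n m) ρ, joint (hReg f b) w ≤ joint (hReg f b) z
        + fderiv ℝ (joint (hReg f b)) z (w - z) + L * ‖w - z‖ ^ 2)
    (hDg : ∀ z ∈ Metric.closedBall (0 : EucProd n m) ρ,
      ‖fderiv ℝ (gradient (joint f)) z‖ ≤ L')
    (hv : ‖gradY f x y‖ ≤ D * v) (hγ : γ ≤ 1)
    (hΞ : hReg f b x y ≤ Ξ) (hη : 0 ≤ η) (hη' : η ≤ 1 / (4 * L))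
    (hην : η * (b * L' * D) ^ 2 ≤ ν)
    (hz : pt x y ∈ Metric.closedBall 0 ρ)
    (hw : pt (x - η • gradX f x y) y ∈ Metric.closedBall 0 ρ) :
    hReg f b (x - η • gradX f x y) y ≤ Ξ + ν * v ^ 2 - γ * (η / 2 * ‖gradX f x y‖ ^ 2) := by
  have h1 := hdesc _ hz _ hw
  have e : pt (x - η • gradX f x y) y - pt x y = (-η) • pt (gradX f x y) 0 := by
    simp [pt, ← WithLp.toLp_sub, ← WithLp.toLp_smul, ← WithLp.toLp_neg]
  rw [e, map_smul, smul_eq_mul, hf.fderiv_hReg, norm_smul, norm_pt_zero_right, norm_neg,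
    Real.norm_of_nonneg hη, inner_gradient_left,
    ← (hasFDerivAt_partial_left (hf.differentiable _)).2, real_inner_self_eq_norm_sq,
    ← hf.gradY_eq] at h1
  change hReg f b (x - η • gradX f x y) y ≤ hReg f b x y + _ + _ at h1
  set a := ‖gradX f x y‖ with ha
  set I : ℝ := inner ℝ (gradY f x y)
    (fderiv ℝ (gradient (joint f)) (pt x y) (pt (gradX f x y) 0)).snd with hI
  -- I is the mixed-derivative term that the penalty adds to ∂ₓh_b; it has no sign.
  have h2 : -I ≤ D * v * (L' * a) := by
    have h3 : ‖(fderiv ℝ (gradient (joint f)) (pt x y) (pt (gradX f x y) 0)).snd‖ ≤ L' * a := by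
      refine (norm_euc_snd_le _).trans ((ContinuousLinearMap.le_opNorm _ _).trans ?_)
      rw [norm_pt_zero_right]
      exact mul_le_mul_of_nonneg_right (hDg _ hz) (norm_nonneg _)
    refine (neg_le_abs I).trans ((abs_real_inner_le_norm _ _).trans ?_)
    exact mul_le_mul hv h3 (norm_nonneg _) ((norm_nonneg _).trans hv)
  rw [le_div_iff₀ (by positivity)] at hη'
  have h4 := mul_le_mul_of_nonneg_left (mul_le_mul_of_nonneg_left h2 hb.le) hη
  -- Young's inequality splits the mixed term: a quarter of ηa² plus η(bL'Dv)² ≤ νv². Another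
  -- quarter pays for the second-order term, leaving -ηa²/2.
  have h5 := mul_nonneg hη (sq_nonneg (a / 2 - b * L' * D * v))
  have h6 := mul_le_mul_of_nonneg_right hην (sq_nonneg v)
  have h7 := mul_nonneg (mul_nonneg hη (sub_nonneg.2 hη')) (sq_nonneg a)
  have h8 := mul_nonneg (mul_nonneg hη (sub_nonneg.2 hγ)) (sq_nonneg a)
  nlinarith

theorem pt_mem_closedBall {x u : Euc n} {y v : Euc m} {ρ r : ℝ} (h : ‖pt x y‖ ≤ ρ)
    (hu : ‖u‖ + ‖v‖ ≤ r) : pt (x + u) (y + v) ∈ Metric.closedBall 0 (ρ + r) := by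
  have e : pt (x + u) (y + v) = pt x y + pt u v := by simp [pt, ← WithLp.toLp_add]
  rw [mem_closedBall_zero_iff, e]
  exact (norm_add_le _ _).trans (add_le_add h ((norm_le_fst_add_snd _).trans hu))

theorem GDARun.hReg_le_Ξ (R : GDARun f P) (k : ℕ) : hReg f (R.β k) (R.x k) (R.y k) ≤ R.Ξ k :=
  R.Ξ_eq k ▸ le_max_right _ _

set_option maxHeartbeats 1000000 in
theorem GDARun.exists_decrease (hf : NCSCProblem f μ) (R : GDARun f P) {M : ℝ}
    (hM : ∀ k, ‖R.z k‖ ≤ M) : ∃ b > 0, ∃ κ > 0, ∃ C > 0, ∃ (s : ℕ → ℝ) (K : ℕ), (∀ k, 0 ≤ s k) ∧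
      ∀ k ≥ K, R.β k = b ∧ hReg f b (R.x (k + 1)) (R.y (k + 1)) ≤ R.Ξ k - κ * s k ^ 2 ∧
        ‖R.z (k + 1) - R.z k‖ ≤ C * s k ∧ ‖gradient (joint f) (R.z k)‖ ≤ C * s k ∧
        ‖gradient (joint f) (R.z (k + 1))‖ ≤ C * s k := by
  obtain ⟨b, hb, K, hK⟩ := R.exists_β_eq hf
  have hx := P.ηxMin_pos.trans P.ηxMin_lt
  have hy := P.ηyMin_pos.trans P.ηyMin_lt
  have hc := P.c_pos
  have hα := P.α_mem.1
  have hγx := P.γx_pos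
  have hγy := sub_pos.2 P.γy_lt
  have hγ := sub_pos.2 P.γx_lt
  have hgc : Continuous (gradient (joint f)) := hf.contDiff_gradient.continuous
  obtain ⟨B₀, hB₀, hgB₀⟩ := hgc.exists_norm_le_closedBall M
  -- The ball of radius `M₁` contains every trial point of the y-search and that of radius `ρ` every
  -- trial point of the x-search, so all constants are uniform in k.
  set M₁ := M + P.ηyMax * B₀ with hM₁
  obtain ⟨B₁, hB₁, hgB₁⟩ := hgc.exists_norm_le_closedBall M₁
  set ρ := M₁ + P.ηxMax * B₁ with hρ
  obtain ⟨L, hL, hdesc⟩ := (hf.contDiff_hReg b).exists_le_add_fderiv_closedBall ρ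
  obtain ⟨L', hL', hDg, hlip⟩ :=
    (hf.contDiff_gradient.of_le (m := 1) (by norm_num)).exists_lipschitz_closedBall ρ
  have hM₁ρ : M₁ ≤ ρ := by rw [hρ]; linarith [mul_pos hx hB₁]
  have hMρ : M ≤ ρ := by linarith [mul_pos hy hB₀]
  set ly := min P.ηyMin (P.α * ((1 - P.γy) * P.c / L)) with hly
  have hly0 : 0 < ly := lt_min P.ηyMin_pos (by positivity)
  set D := L' * P.ηyMax + 1 with hD
  have hD0 : 0 < D := by positivity
  -- The second entry lets the surplus (γ_y - γ_x)cη_y‖∇_y f‖² of the ascent step, with η_y ≥ `ly`,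
  -- pay for the mixed term of the x-step; this is where γ_x < γ_y enters.
  set t := min (1 / (4 * L)) ((P.γy - P.γx) * P.c * ly / (b * L' * D) ^ 2) with ht
  have ht0 : 0 < t := lt_min (by positivity) (by positivity)
  set lx := min P.ηxMin (P.α * t) with hlx
  have hlx0 : 0 < lx := lt_min P.ηxMin_pos (by positivity)
  set C₀ := P.ηxMax + P.ηyMax with hC₀
  refine ⟨b, hb, P.γx * min (P.c * ly) (lx / 2) / 2, by positivity,
    C₀ + D + L' * C₀, by positivity,
    fun k => ‖gradX f (R.x k) (R.y (k + 1))‖ + ‖gradY f (R.x k) (R.y k)‖, K,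
    fun k => by positivity, fun k hk => ⟨hK k hk, ?_⟩⟩
  have hzM : ‖pt (R.x k) (R.y k)‖ ≤ M := hM k
  have hz : pt (R.x k) (R.y k) ∈ Metric.closedBall 0 ρ := by
    rw [mem_closedBall_zero_iff]; linarith
  have hβ := hK k hk
  have hΞ := hβ ▸ R.hReg_le_Ξ k
  have hexit : inner ℝ (gradY (hReg f b) (R.x k) (R.y k)) (gradY f (R.x k) (R.y k))
      ≤ -P.c * ‖gradY f (R.x k) (R.y k)‖ ^ 2 := by
    obtain ⟨_, -, h, -⟩ := R.β_loop k
    exact not_lt.1 (hβ ▸ h)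
  have hgY : ‖gradY f (R.x k) (R.y k)‖ ≤ B₀ := by
    rw [hf.gradY_eq]
    exact (norm_euc_snd_le _).trans (hgB₀ _ (mem_closedBall_zero_iff.2 hzM))
  have hyball : ∀ η, 0 < η → η ≤ P.ηyMax →
      pt (R.x k) (R.y k + η • gradY f (R.x k) (R.y k)) ∈ Metric.closedBall 0 M₁ := by
    intro η h0 h1
    have := pt_mem_closedBall (u := 0) (v := η • gradY f (R.x k) (R.y k)) (r := P.ηyMax * B₀) hzM (by
      rw [norm_zero, zero_add, norm_smul, Real.norm_of_nonneg h0.le]; gcongr)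
    rwa [add_zero] at this
  have hys := R.ηy_search k
  rw [hβ] at hys
  obtain ⟨hη0, hη1, hηacc, hηl⟩ := hys.bounds (t := (1 - P.γy) * P.c / L) P.ηyMin_pos
    (R.ηyInit_mem k) P.α_mem
    (fun s s0 s1 s2 => hReg_ascent_step_le hf hL hdesc hexit hΞ s0.le s2 hz
      (Metric.closedBall_subset_closedBall hM₁ρ (hyball s s0 s1)))
  have hyb := hyball _ hη0 hη1
  rw [← R.y_succ] at hyb hηacc
  have hz' : pt (R.x k) (R.y (k + 1)) ∈ Metric.closedBall 0 ρ :=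
    Metric.closedBall_subset_closedBall hM₁ρ hyb
  have hgdiff : ‖gradient (joint f) (pt (R.x k) (R.y (k + 1)))
      - gradient (joint f) (pt (R.x k) (R.y k))‖ ≤ L' * P.ηyMax * ‖gradY f (R.x k) (R.y k)‖ := by
    refine (hlip _ hz _ hz').trans ?_
    have e : pt (R.x k) (R.y (k + 1)) - pt (R.x k) (R.y k)
        = R.ηy k • pt 0 (gradY f (R.x k) (R.y k)) := by
      rw [R.y_succ]; simp [pt, ← WithLp.toLp_sub, ← WithLp.toLp_smul]
    rw [e, norm_smul, norm_pt_zero_left, Real.norm_of_nonneg hη0.le, mul_assoc]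
    gcongr
  have hgY' : ‖gradY f (R.x k) (R.y (k + 1))‖ ≤ D * ‖gradY f (R.x k) (R.y k)‖ := by
    have h1 : ‖gradY f (R.x k) (R.y (k + 1)) - gradY f (R.x k) (R.y k)‖
        ≤ L' * P.ηyMax * ‖gradY f (R.x k) (R.y k)‖ := by
      refine le_trans ?_ hgdiff
      rw [hf.gradY_eq, hf.gradY_eq, ← WithLp.sub_snd]
      exact norm_euc_snd_le _
    have h2 := norm_le_norm_add_norm_sub' (gradY f (R.x k) (R.y (k + 1)))
      (gradY f (R.x k) (R.y k))
    rw [hD]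
    linarith
  have hgX : ‖gradX f (R.x k) (R.y (k + 1))‖ ≤ B₁ := by
    rw [hf.gradX_eq]
    exact (norm_euc_fst_le _).trans (hgB₁ _ hyb)
  have hxball : ∀ η, 0 < η → η ≤ P.ηxMax →
      pt (R.x k - η • gradX f (R.x k) (R.y (k + 1))) (R.y (k + 1)) ∈ Metric.closedBall 0 ρ := by
    intro η h0 h1
    have := pt_mem_closedBall (u := -(η • gradX f (R.x k) (R.y (k + 1)))) (v := 0)
      (r := P.ηxMax * B₁) (mem_closedBall_zero_iff.1 hyb) (by
      rw [norm_zero, add_zero, norm_neg, norm_smul, Real.norm_of_nonneg h0.le]; gcongr)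
    rwa [add_zero, ← sub_eq_add_neg] at this
  have hxs := R.ηx_search k
  rw [hβ] at hxs
  obtain ⟨hξ0, hξ1, hξacc, hξl⟩ := hxs.bounds (t := t) P.ηxMin_pos
    (R.ηxInit_mem k) P.α_mem (fun s s0 s1 s2 => by
      have h1 := hReg_descent_step_le hf (ν := (P.γy - P.γx) * P.c * R.ηy k) hb hL hdesc hDg
        hgY' (P.γx_lt.trans P.γy_lt).le hηacc s0.le (s2.trans (min_le_left _ _)) (by
          have h2 := s2.trans (min_le_right _ _)
          rw [le_div_iff₀ (by positivity)] at h2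
          refine h2.trans ?_
          gcongr) hz' (hxball s s0 s1)
      linarith)
  rw [← R.x_succ] at hξacc
  set A := ‖gradX f (R.x k) (R.y (k + 1))‖ with hA
  set B := ‖gradY f (R.x k) (R.y k)‖ with hB
  have hA0 : 0 ≤ A := norm_nonneg _
  have hB0 : 0 ≤ B := norm_nonneg _
  have hstep : ‖R.z (k + 1) - R.z k‖ ≤ C₀ * (A + B) := by
    refine (norm_le_fst_add_snd _).trans ?_
    have e1 : (R.z (k + 1) - R.z k).fst = -(R.ηx k • gradX f (R.x k) (R.y (k + 1))) := by
      change R.x (k + 1) - R.x k = _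
      rw [R.x_succ]; abel
    have e2 : (R.z (k + 1) - R.z k).snd = R.ηy k • gradY f (R.x k) (R.y k) := by
      change R.y (k + 1) - R.y k = _
      rw [R.y_succ]; abel
    rw [e1, e2, norm_neg, norm_smul, norm_smul, Real.norm_of_nonneg hη0.le,
      Real.norm_of_nonneg hξ0.le]
    have h1 : R.ηx k * A ≤ P.ηxMax * A := by gcongr
    have h2 : R.ηy k * B ≤ P.ηyMax * B := by gcongr
    have h3 := mul_nonneg hx.le hB0
    have h4 := mul_nonneg hy.le hA0
    rw [hC₀]
    linarith
  have hgk : ‖gradient (joint f) (R.z k)‖ ≤ D * (A + B) := by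
    refine (norm_le_fst_add_snd _).trans ?_
    change ‖(gradient (joint f) (pt (R.x k) (R.y k))).fst‖
      + ‖(gradient (joint f) (pt (R.x k) (R.y k))).snd‖ ≤ _
    rw [← hf.gradX_eq, ← hf.gradY_eq]
    have h1 : ‖gradX f (R.x k) (R.y (k + 1)) - gradX f (R.x k) (R.y k)‖
        ≤ L' * P.ηyMax * ‖gradY f (R.x k) (R.y k)‖ := by
      refine le_trans ?_ hgdiff
      rw [hf.gradX_eq, hf.gradX_eq, ← WithLp.sub_fst]
      exact norm_euc_fst_le _
    have h2 := norm_le_norm_add_norm_sub (gradX f (R.x k) (R.y (k + 1)))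
      (gradX f (R.x k) (R.y k))
    have h3 := mul_nonneg (mul_pos hL' hy).le hA0
    rw [hD]
    linarith
  have hgk1 : ‖gradient (joint f) (R.z (k + 1))‖ ≤ (D + L' * C₀) * (A + B) := by
    have h1 := hlip (R.z k) hz (R.z (k + 1)) (by
      rw [mem_closedBall_zero_iff]; exact (hM _).trans hMρ)
    have h2 := norm_le_norm_add_norm_sub' (gradient (joint f) (R.z (k + 1)))
      (gradient (joint f) (R.z k))
    have h3 := mul_le_mul_of_nonneg_left hstep hL'.le
    linarith
  have hAB : 0 ≤ A + B := by positivity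
  have hC₀0 : 0 < C₀ := by positivity
  refine ⟨?_, ?_, ?_, ?_⟩
  · set w := min (P.c * ly) (lx / 2) with hw
    have w1 : w ≤ P.c * R.ηy k := (min_le_left _ _).trans (by gcongr)
    have w2 : w ≤ R.ηx k / 2 := (min_le_right _ _).trans (by linarith)
    have w0 : 0 ≤ w := by positivity
    have h1 : w * B ^ 2 ≤ P.c * R.ηy k * B ^ 2 := by gcongr
    have h2 : w * A ^ 2 ≤ R.ηx k / 2 * A ^ 2 := by gcongr
    have h3 : w / 2 * (A + B) ^ 2 ≤ P.c * R.ηy k * B ^ 2 + R.ηx k / 2 * A ^ 2 := by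
      have h5 := mul_nonneg w0 (sq_nonneg (A - B))
      calc w / 2 * (A + B) ^ 2 = w * B ^ 2 + w * A ^ 2 - w * (A - B) ^ 2 / 2 := by ring
        _ ≤ w * B ^ 2 + w * A ^ 2 := by linarith only [h5]
        _ ≤ _ := add_le_add h1 h2
    refine hξacc.trans (sub_le_sub_left ?_ _)
    calc P.γx * w / 2 * (A + B) ^ 2 = P.γx * (w / 2 * (A + B) ^ 2) := by ring
      _ ≤ _ := mul_le_mul_of_nonneg_left h3 hγx.le
  · refine hstep.trans ?_
    gcongr
    linarith [mul_pos hL' hC₀0]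
  · refine hgk.trans ?_
    gcongr
    linarith [mul_pos hL' hC₀0]
  · refine hgk1.trans ?_
    gcongr
    linarith

/-- With β unchanged, H is averaged with the same weights as F and G, towards h_b(z_{k+1}). Since
that value is at most Ξ_k, replacing τ_k by the smaller τ only raises the bound. -/
theorem GDARun.Ξ_succ_le (R : GDARun f P) {b : ℝ} {k : ℕ} (hk : R.β k = b)
    (hk1 : R.β (k + 1) = b) (h : hReg f b (R.x (k + 1)) (R.y (k + 1)) ≤ R.Ξ k) :
    R.Ξ (k + 1) ≤ (1 - P.τ) * R.Ξ k + P.τ * hReg f b (R.x (k + 1)) (R.y (k + 1)) := by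
  obtain ⟨h1, h2⟩ := P.τs_mem k
  have hH : R.H (k + 1) = (1 - P.τs k) * R.H k
      + P.τs k * hReg f b (R.x (k + 1)) (R.y (k + 1)) := by
    rw [R.H_eq, R.H_eq, R.F_succ, R.G_succ, hk, hk1, hReg]; ring
  have hHΞ : R.H k ≤ R.Ξ k := R.Ξ_eq k ▸ le_max_left _ _
  rw [R.Ξ_eq (k + 1), hk1, hH]
  refine max_le ?_ ?_
  · nlinarith
  · nlinarith [P.τ_mem.2]

end Run

/-! ### From the KL property of the value function to the regularized objective -/

section Convergence

variable {n m : ℕ} {f : Euc n → Euc m → ℝ} {μ : ℝ} {P : GDAInput n m}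

/-- ∇Φ(x) is ∇ₓf at the maximizer, which by the error bound is within ‖∇f(z)‖/μ of z; a Lipschitz
bound on ∇f over the enlarged ball does the rest. -/
theorem NCSCProblem.exists_norm_gradient_valueFn_le (hf : NCSCProblem f μ) (M : ℝ) :
    ∃ C > 0, ∀ z ∈ Metric.closedBall (0 : EucProd n m) M,
      ‖gradient (valueFn f) z.fst‖ ≤ C * ‖gradient (joint f) z‖ := by
  have hμ := hf.mu_pos
  obtain ⟨B, hB, hgB⟩ := hf.contDiff_gradient.continuous.exists_norm_le_closedBall M
  obtain ⟨L, hL, -, hlip⟩ := (hf.contDiff_gradient.of_le (m := 1)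
    (by norm_num)).exists_lipschitz_closedBall (M + B / μ)
  refine ⟨1 + L / μ, by positivity, fun z hz => ?_⟩
  have h1 : ‖pt z.fst (hf.argmax z.fst) - z‖ ≤ ‖gradient (joint f) z‖ / μ := by
    have e : pt z.fst (hf.argmax z.fst) - z = pt 0 (hf.argmax z.fst - z.snd) := by
      have : pt z.fst (hf.argmax z.fst) - z
        = pt (z.fst - z.fst) (hf.argmax z.fst - z.snd) := rfl
      rw [this, sub_self]
    rw [e, norm_pt_zero_left]
    refine (hf.norm_sub_argmax_le _ _).trans ?_
    gcongr
    rw [hf.gradY_eq]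
    exact norm_euc_snd_le _
  have hz' := mem_closedBall_zero_iff.1 hz
  have h2 : ‖gradient (joint f) z‖ / μ ≤ B / μ := by gcongr; exact hgB z hz
  have h3 := hlip z (mem_closedBall_zero_iff.2 (hz'.trans (by linarith [div_pos hB hμ])))
    (pt z.fst (hf.argmax z.fst)) (mem_closedBall_zero_iff.2 (by
      linarith [norm_le_norm_add_norm_sub' (pt z.fst (hf.argmax z.fst)) z]))
  have h4 := norm_le_norm_add_norm_sub' (gradient (joint f) (pt z.fst (hf.argmax z.fst)))
    (gradient (joint f) z)
  have h5 := mul_le_mul_of_nonneg_left h1 hL.le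
  rw [hf.gradient_valueFn, hf.gradX_eq]
  refine (norm_euc_fst_le _).trans ?_
  calc _ ≤ ‖gradient (joint f) z‖ + L * (‖gradient (joint f) z‖ / μ) := by linarith
    _ = _ := by ring

/-- One-sided substitute for a KL inequality of h_b, valid for every b > 0: f ≤ Φ reduces the value
gap to that of Φ, and the penalty is harmless because a² ≤ a^(1/θ) for a ≤ 1 and θ ≥ 1/2. -/
theorem KLAt.exists_hReg_sub_le (hf : NCSCProblem f μ) {θ b : ℝ} (p : EucProd n m)
    (hb : 0 < b) (h : KLAt (valueFn f) p.fst θ) :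
    ∃ r > 0, ∃ C > 0, ∀ z ∈ Metric.ball p r, ‖gradient (joint f) z‖ ≤ 1 →
      joint (hReg f b) z - valueFn f p.fst ≤ C * ‖gradient (joint f) z‖ ^ (1 / θ) := by
  obtain ⟨⟨hθ1, hθ2⟩, c, hc, U, hU, hKL⟩ := h
  have hθ : 0 < θ := by linarith
  obtain ⟨r, hr, hrU⟩ := Metric.mem_nhds_iff.1 hU
  obtain ⟨C, hC, hgrad⟩ := hf.exists_norm_gradient_valueFn_le (‖p‖ + 1)
  refine ⟨min r 1, by positivity, b / 2 + (C / c) ^ (1 / θ), by positivity, fun z hz hz1 => ?_⟩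
  set a := ‖gradient (joint f) z‖ with ha
  have ha0 : 0 ≤ a := norm_nonneg _
  rw [Metric.mem_ball, dist_eq_norm, lt_min_iff] at hz
  have h1 := hKL z.fst (hrU (by
    rw [Metric.mem_ball, dist_eq_norm, ← WithLp.sub_fst]
    exact (norm_euc_fst_le _).trans_lt hz.1))
  have h2 := hgrad z (mem_closedBall_zero_iff.2 (by
    linarith [norm_le_norm_add_norm_sub' z p, hz.2]))
  have h3 : valueFn f z.fst - valueFn f p.fst ≤ (C / c) ^ (1 / θ) * a ^ (1 / θ) := by
    rw [← Real.mul_rpow (by positivity) ha0]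
    refine (le_abs_self _).trans ?_
    rw [one_div, Real.le_rpow_inv_iff_of_pos (abs_nonneg _) (by positivity) hθ,
      div_mul_eq_mul_div, le_div_iff₀ hc]
    linarith
  have h4 : joint (hReg f b) z ≤ valueFn f z.fst + b / 2 * a ^ 2 := by
    change f z.fst z.snd + b / 2 * ‖gradY f z.fst z.snd‖ ^ 2 ≤ _
    rw [hf.valueFn_eq]
    have : ‖gradY f z.fst z.snd‖ ≤ a := by rw [hf.gradY_eq]; exact norm_euc_snd_le _
    gcongr
    exact hf.le_argmax _ _
  have h5 : a ^ 2 ≤ a ^ (1 / θ) := by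
    rcases ha0.eq_or_lt with h0 | h0
    · rw [← h0, zero_pow two_ne_zero]; positivity
    · rw [← Real.rpow_two]
      refine Real.rpow_le_rpow_of_exponent_ge h0 hz1 ?_
      rw [div_le_iff₀ hθ]; linarith
  have h6 : b / 2 * a ^ 2 ≤ b / 2 * a ^ (1 / θ) := by gcongr
  rw [add_mul]
  linarith

end Convergence

theorem mainTheorem7 {n m : ℕ} (f : Euc n → Euc m → ℝ) (μ : ℝ) (hf : NCSCProblem f μ)
    (P : GDAInput n m) (R : GDARun f P)
    (hbdd : ∃ M > 0, ∀ k, R.z k ∈ Metric.closedBall (0 : EucProd n m) M) :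
    -- global convergence and iteration complexity
    (Differentiable ℝ (valueFn f) ∧
      Tendsto (fun k => gradient (joint f) (R.z k)) atTop (𝓝 0) ∧
      Tendsto (fun k => gradient (valueFn f) (R.x k)) atTop (𝓝 0) ∧
      (fun T : ℕ => runningMin (fun k => ‖gradient (joint f) (R.z k)‖) T)
        =O[atTop] (fun T : ℕ => (T : ℝ) ^ (-(1 / 2) : ℝ)) ∧
      (fun T : ℕ => runningMin (fun k => ‖gradient (valueFn f) (R.x k)‖) T)
        =O[atTop] (fun T : ℕ => (T : ℝ) ^ (-(1 / 2) : ℝ))) ∧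
    -- convergence of the iterates and local rates under the KL property of the value function
    ((∀ p : Euc n, gradient (valueFn f) p = 0 → ∃ θ, KLAt (valueFn f) p θ) →
      ∃ (xs : Euc n) (ys : Euc m), IsFirstOrderMinimax f xs ys ∧
        Tendsto R.z atTop (𝓝 (pt xs ys)) ∧
        ∀ θ, KLAt (valueFn f) xs θ →
          (θ = 1 / 2 → ∃ q ∈ Set.Ioo (0 : ℝ) 1,
            (fun k => ‖R.z k - pt xs ys‖) =O[atTop] (fun k : ℕ => q ^ k)) ∧
          (1 / 2 < θ →
            (fun k => ‖R.z k - pt xs ys‖)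
              =O[atTop] (fun k : ℕ => (k : ℝ) ^ (-((1 - θ) / (2 * θ - 1)))))) := by
  obtain ⟨M, -, hM⟩ := hbdd
  obtain ⟨b, hb, κ, hκ, C, hC, s, K, hs0, hK⟩ :=
    R.exists_decrease hf fun k => mem_closedBall_zero_iff.1 (hM k)
  obtain ⟨D, hD, hgrad⟩ := hf.exists_norm_gradient_valueFn_le M
  have hτ := P.τ_mem
  have hΞ : ∀ k ≥ K, R.Ξ (k + 1) ≤ (1 - P.τ) * R.Ξ k + P.τ * joint (hReg f b) (R.z (k + 1)) :=
    fun k hk => R.Ξ_succ_le (hK k hk).1 (hK (k + 1) (by omega)).1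
      ((hK k hk).2.1.trans (sub_le_self _ (by positivity)))
  obtain ⟨B, -, hB⟩ := hf.contDiff.continuous.exists_norm_le_closedBall M
  obtain ⟨l, hΞl, hhl, hlΞ, hdec, hsum⟩ := exists_tendsto_of_nonmonotone_decrease
    (h := fun k => joint (hReg f b) (R.z k)) (B := -B) hτ.1 hκ (fun k => by
      refine le_trans ?_ (R.hReg_le_Ξ k)
      have h1 := neg_le_of_abs_le (hB _ (hM k))
      have h2 := (R.β_pos k).2
      change -B ≤ f (R.x k) (R.y k) at h1
      rw [hReg]
      linarith [mul_nonneg (half_pos h2).le (sq_nonneg ‖gradY f (R.x k) (R.y k)‖)])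
    hΞ (fun k hk => (hK k hk).2.1)
  have hs : Tendsto s atTop (𝓝 0) := by
    have := hsum.tendsto_atTop_zero.sqrt
    simpa [Real.sqrt_sq (hs0 _)] using this
  have hg : Tendsto (fun k => gradient (joint f) (R.z k)) atTop (𝓝 0) := by
    refine squeeze_zero_norm' (a := fun k => C * s k) ?_ (by simpa using hs.const_mul C)
    filter_upwards [eventually_ge_atTop K] with k hk using (hK k hk).2.2.2.1
  have hgsum : Summable fun k => ‖gradient (joint f) (R.z k)‖ ^ 2 := by
    refine Summable.of_norm_bounded_eventually_nat (hsum.mul_left (C ^ 2)) ?_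
    filter_upwards [eventually_ge_atTop K] with k hk
    rw [Real.norm_of_nonneg (sq_nonneg _), ← mul_pow]
    exact pow_le_pow_left₀ (norm_nonneg _) (hK k hk).2.2.2.1 2
  have hΦ : ∀ k, ‖gradient (valueFn f) (R.x k)‖ ≤ D * ‖gradient (joint f) (R.z k)‖ :=
    fun k => hgrad (R.z k) (hM k)
  have hΦsum : Summable fun k => ‖gradient (valueFn f) (R.x k)‖ ^ 2 := by
    refine Summable.of_nonneg_of_le (fun _ => sq_nonneg _) (fun k => ?_) (hgsum.mul_left (D ^ 2))
    rw [← mul_pow]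
    exact pow_le_pow_left₀ (norm_nonneg _) (hΦ k) 2
  refine ⟨⟨fun x => (hf.hasGradientAt_valueFn x).differentiableAt, hg, squeeze_zero_norm hΦ
    (by simpa using hg.norm.const_mul D), runningMin_isBigO (fun _ => norm_nonneg _) hgsum,
    runningMin_isBigO (fun _ => norm_nonneg _) hΦsum⟩, fun hKL => ?_⟩
  -- A cluster point p is stationary for f, so its y-part is the maximizer and the penalty vanishes
  -- there; hence l = Φ(`p.fst`).
  obtain ⟨p, -, φ, hφ, hp⟩ := (isCompact_closedBall (0 : EucProd n m) M).tendsto_subseq hM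
  have hcl : MapClusterPt p atTop R.z := hp.mapClusterPt.of_comp hφ.tendsto_atTop
  have hgp : gradient (joint f) p = 0 := tendsto_nhds_unique
    ((hf.contDiff_gradient.continuous.tendsto p).comp hp) (hg.comp hφ.tendsto_atTop)
  have hhp : joint (hReg f b) p = l := tendsto_nhds_unique
    (((hf.contDiff_hReg b).continuous.tendsto p).comp hp) (hhl.comp hφ.tendsto_atTop)
  have hYp : gradY f p.fst p.snd = 0 := by
    rw [hf.gradY_eq]
    change (gradient (joint f) p).snd = 0
    rw [hgp]; rfl
  have harg := hf.argmax_eq hYp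
  have hΦp : gradient (valueFn f) p.fst = 0 := by
    rw [hf.gradient_valueFn, harg, hf.gradX_eq]
    change (gradient (joint f) p).fst = 0
    rw [hgp]; rfl
  have hlp : valueFn f p.fst = l := by
    rw [← hhp, hf.valueFn_eq, harg, joint, hReg, hYp]; simp
  -- Stated for every θ, since the rate is claimed for each KL exponent at the limit and not only
  -- for the one used to get convergence.
  have main : ∀ θ, KLAt (valueFn f) p.fst θ → Tendsto R.z atTop (𝓝 p) ∧
      (θ = 1 / 2 → ∃ q ∈ Set.Ioo (0 : ℝ) 1,
        (fun k => dist (R.z k) p) =O[atTop] (fun k : ℕ => q ^ k)) ∧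
      (1 / 2 < θ → (fun k => dist (R.z k) p)
        =O[atTop] (fun k : ℕ => (k : ℝ) ^ (-((1 - θ) / (2 * θ - 1))))) := by
    intro θ hθ
    obtain ⟨r, hr, C₁, hC₁, hloc⟩ := hθ.exists_hReg_sub_le hf p hb
    have hθ0 : 0 < θ := by linarith [hθ.1.1]
    have hδ : Tendsto (fun k => R.Ξ k - l) atTop (𝓝 0) := by simpa using hΞl.sub_const l
    have hg1 : ∀ᶠ k in atTop, ‖gradient (joint f) (R.z (k + 1))‖ ≤ 1 :=
      (tendsto_add_atTop_nat 1).eventually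
        ((by simpa using hg.norm : Tendsto _ _ (𝓝 (0 : ℝ))).eventually_le_const zero_lt_one)
    refine hcl.tendsto_and_rates (δ := fun k => R.Ξ k - l) (s := s) (C := C₁ * C ^ (1 / θ))
      hθ.1 hτ.1 (mul_pos hτ.1 hκ) (by positivity) hC hr hδ ?_ hs0 hs ?_ ?_ ?_
    · filter_upwards [eventually_ge_atTop K] with k hk using sub_nonneg.2 (hlΞ k hk)
    · filter_upwards [eventually_ge_atTop K] with k hk
      rw [dist_comm, dist_eq_norm]
      exact (hK k hk).2.2.1
    · filter_upwards [eventually_ge_atTop K] with k hk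
      linarith [hdec k hk]
    · filter_upwards [eventually_ge_atTop K, hg1] with k hk hk1 hball
      have h1 := hloc _ hball hk1
      have h2 : ‖gradient (joint f) (R.z (k + 1))‖ ^ (1 / θ) ≤ C ^ (1 / θ) * s k ^ (1 / θ) := by
        rw [← Real.mul_rpow hC.le (hs0 k)]
        exact Real.rpow_le_rpow (norm_nonneg _) (hK k hk).2.2.2.2 (by positivity)
      have h3 := mul_le_mul_of_nonneg_left h2 hC₁.le
      rw [hlp] at h1
      have h4 : 0 ≤ C₁ * C ^ (1 / θ) * s k ^ (1 / θ) := by have := hs0 k; positivity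
      have h5 := mul_le_mul_of_nonneg_left
        (show joint (hReg f b) (R.z (k + 1)) - l ≤ C₁ * C ^ (1 / θ) * s k ^ (1 / θ) by linarith)
        hτ.1.le
      have h6 := mul_le_of_le_one_left h4 hτ.2
      linarith [hΞ k hk]
  obtain ⟨θ, hθ⟩ := hKL _ hΦp
  refine ⟨p.fst, p.snd, ⟨?_, fun y' => ?_⟩, (main θ hθ).1, fun θ' hθ' => ?_⟩
  · rw [← hΦp, hf.gradient_valueFn]
    exact hf.hasGradientAt_valueFn p.fst
  · rw [← harg]
    exact hf.le_argmax _ _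
  · simp only [← dist_eq_norm]
    exact (main θ' hθ').2
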